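/- Let $(Y,\omega,b)$ be a locally conformal pre-symplectic (l.c.p.s.) manifold: $Y$ is a smooth manifold, $b$ a closed one-form and $\omega$ a two-form of constant rank on $Y$ with $d^b\omega := d\omega + b\wedge\omega = 0$. Let $E=(TY)^\omega=\ker\omega$, let $\pi:E^*\to Y$ be the dual bundle, choose a splitting $TY=G\oplus E$ with projection $p_G:TY\to E$ along $G$, let $\theta_G$ be the one-form on $E^*$ given by $\theta_{G,\alpha}(\zeta)=\alpha(p_G(T\pi\,\zeta))$ for $\alpha\in E^*$ and $\zeta\in T_\alpha E^*$, and put $\omega_G=\pi^*\omega-d\theta_G-\pi^*b\wedge\theta_G$. Let $U\subset E^*$ be any open neighbourhood of the zero section (identified with $Y$) on which $\omega_G$ is non-degenerate; $(U,\omega_G,\pi^*b)$ is the thickening. A smooth vector field $\xi$ on a manifold with such a pair $(\omega,b)$ is called l.c.p.s. (l.c.s. when $\omega$ is non-degenerate) if there is a smooth function $u$ with $\mathcal L_\xi\omega=-u\,\omega$ and $\mathcal L_\xi b=du$, and pre-Hamiltonian (Hamiltonian when $\omega$ is non-degenerate) if $\xi\lrcorner\omega=d^bf:=df+f\,b$ for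 some smooth function $f$. Theorem 6.5. Every l.c.p.s. vector field $\xi$ on $(Y,\omega,b)$ extends to an l.c.s. vector field $X$ on $(U,\omega_G,\pi^*b)$, i.e. $X$ restricts to $\xi$ along the zero section $Y\subset U$. Likewise, every pre-Hamiltonian vector field on $(Y,\omega,b)$ extends to a Hamiltonian vector field on $(U,\omega_G,\pi^*b)$. -/

import Mathlib

open scoped Manifold ContDiff Topology
open Bundle Set

set_option linter.unusedSectionVars false

noncomputable section

namespace LCS

section Forms

variable {E : Type*} [NormedAddCommGroup E] [NormedSpace ℝ E]
  {H : Type*} [TopologicalSpace H] (I : ModelWithCorners ℝ E H)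
  {M : Type*} [TopologicalSpace M] [ChartedSpace H M]

variable (M) in
/-- Differential `k`-forms on `M` (without any regularity requirement). -/
abbrev Form (k : ℕ) := (x : M) → TangentSpace I x [⋀^Fin k]→L[ℝ] ℝ

variable {I} {k : ℕ}

/-- The coordinate expression of a form in the preferred chart at `x₀`, i.e. its pull-back under the
inverse of that chart. -/
def Form.inChart (η : Form I M k) (x₀ : M) (z : E) : E [⋀^Fin k]→L[ℝ] ℝ :=
  (η ((extChartAt I x₀).symm z)).compContinuousLinearMap
    (mfderiv 𝓘(ℝ, E) I (extChartAt I x₀).symm z)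

/-- A form is smooth on `U` if its coordinate expressions in all charts are smooth. -/
def Form.SmoothOn (η : Form I M k) (U : Set M) : Prop :=
  ∀ x₀ : M, ContDiffOn ℝ ∞ (η.inChart x₀)
    ((extChartAt I x₀).target ∩ (extChartAt I x₀).symm ⁻¹' U)

/-- The exterior derivative, computed at `x` in the preferred chart at `x`. -/
def Form.d (η : Form I M k) : Form I M (k + 1) := fun x =>
  (extDeriv (η.inChart x) (extChartAt I x x)).compContinuousLinearMap
    (mfderiv I 𝓘(ℝ, E) (extChartAt I x) x)

/-- The wedge product `β ∧ η` of a covector `β` with an alternating `k`-form `η`: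
`(β ∧ η) (v₀, …, vₖ) = ∑ i, (-1) ^ i * β vᵢ * η (v₀, …, v̂ᵢ, …, vₖ)`. -/
def wedge {V : Type*} [NormedAddCommGroup V] [NormedSpace ℝ V]
    (β : V [⋀^Fin 1]→L[ℝ] ℝ) (η : V [⋀^Fin k]→L[ℝ] ℝ) : V [⋀^Fin (k + 1)]→L[ℝ] ℝ :=
  ContinuousAlternatingMap.alternatizeUncurryFin
    (((ContinuousAlternatingMap.ofSubsingleton ℝ V ℝ (0 : Fin 1)).symm β).smulRight η)

theorem wedge_apply {V : Type*} [NormedAddCommGroup V] [NormedSpace ℝ V]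
    (β : V [⋀^Fin 1]→L[ℝ] ℝ) (η : V [⋀^Fin k]→L[ℝ] ℝ) (v : Fin (k + 1) → V) :
    wedge β η v = ∑ i : Fin (k + 1), (-1) ^ (i : ℕ) * (β ![v i] * η (i.removeNth v)) := by
  unfold wedge
  rw [ContinuousAlternatingMap.alternatizeUncurryFin_apply]
  refine Finset.sum_congr rfl fun i _ => ?_
  have h : ![v i] = fun _ : Fin 1 => v i := by ext j; fin_cases j; rfl
  rw [h, zsmul_eq_mul]
  push_cast
  rfl

/-- The wedge product of a one-form with a `k`-form on a manifold. -/
def Form.wedge (β : Form I M 1) (η : Form I M k) : Form I M (k + 1) := fun x =>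
  LCS.wedge (V := E) (β x) (η x)

/-- The twisted differential `d^b η = dη + b ∧ η`. -/
def Form.twistedD (b : Form I M 1) (η : Form I M k) : Form I M (k + 1) :=
  η.d + b.wedge η

/-- A function regarded as a `0`-form. -/
def Form.ofFun (f : M → ℝ) : Form I M 0 := fun x =>
  ContinuousAlternatingMap.constOfIsEmpty ℝ (TangentSpace I x) (Fin 0) (f x)

/-- The interior product `ξ ⌟ η = η (ξ, ·, …, ·)`. -/
def Form.interior (ξ : (x : M) → TangentSpace I x) (η : Form I M (k + 1)) : Form I M k := fun x =>
  ContinuousAlternatingMap.curryLeft (E := E) (η x) (ξ x)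

/-- The coordinate expression of a vector field in the preferred chart at `x₀`. -/
def vfInChart (ξ : (x : M) → TangentSpace I x) (x₀ : M) (z : E) : E :=
  mfderiv I 𝓘(ℝ, E) (extChartAt I x₀) ((extChartAt I x₀).symm z) (ξ ((extChartAt I x₀).symm z))

/-- The Lie derivative `(𝓛_ξ η)_x (v₁, …, vₖ)`, through its expression in the preferred chart at `x`:
`(𝓛_ξ η) (v₁, …, vₖ) = (Dη · ξ) (v₁, …, vₖ) + ∑ i, η (v₁, …, Dξ · vᵢ, …, vₖ)`. -/
def Form.lieDeriv (ξ : (x : M) → TangentSpace I x) (η : Form I M k) (x : M)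
    (v : Fin k → TangentSpace I x) : ℝ :=
  let z : E := extChartAt I x x
  let w : Fin k → E := fun i => mfderiv I 𝓘(ℝ, E) (extChartAt I x) x (v i)
  fderiv ℝ (η.inChart x) z (vfInChart ξ x z) w +
    ∑ i, η.inChart x z (Function.update w i (fderiv ℝ (vfInChart ξ x) z (w i)))

/-- The null space `(T_x M)^Ω = {v | Ω (v, ·) = 0}` of a two-form at a point. -/
def Form.nullSpace (Ω : Form I M 2) (x : M) : Submodule ℝ (TangentSpace I x) :=
  (ContinuousAlternatingMap.curryLeft (E := E) (Ω x) : E →ₗ[ℝ] E [⋀^Fin 1]→L[ℝ] ℝ).ker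

theorem Form.mem_nullSpace {Ω : Form I M 2} {x : M} {v : TangentSpace I x} :
    v ∈ Ω.nullSpace x ↔ ∀ w, Ω x ![v, w] = 0 := by
  constructor
  · intro h w
    have h' : ContinuousAlternatingMap.curryLeft (E := E) (Ω x) v = 0 := h
    exact congrArg (fun f : E [⋀^Fin 1]→L[ℝ] ℝ => f ![w]) h'
  · intro h
    change ContinuousAlternatingMap.curryLeft (E := E) (Ω x) v = 0
    ext w
    have : w = ![w 0] := by ext j; fin_cases j; rfl
    rw [this]
    exact h (w 0)

variable [IsManifold I ∞ M]

/-- Smooth vector fields on an open subset. -/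
def SmoothVFOn (ξ : (x : M) → TangentSpace I x) (U : Set M) : Prop :=
  ContMDiffOn I I.tangent ∞ (fun x => (⟨x, ξ x⟩ : TangentBundle I M)) U

/-- The vector field `ξ` on the open set `U`, equipped with the two-form `Ω` and the one-form `b`, is
locally conformal (pre-)symplectic: `𝓛_ξ Ω = -u Ω` and `𝓛_ξ b = du` for some `u ∈ C^∞(U)`. -/
def IsConformalVFOn (Ω : Form I M 2) (b : Form I M 1) (U : Set M)
    (ξ : (x : M) → TangentSpace I x) : Prop :=
  SmoothVFOn ξ U ∧ ∃ u : M → ℝ, ContMDiffOn I 𝓘(ℝ, ℝ) ∞ u U ∧ ∀ x ∈ U,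
    (∀ v, Ω.lieDeriv ξ x v = -u x * Ω x v) ∧ (∀ v, b.lieDeriv ξ x v = (Form.ofFun u).d x v)

/-- The vector field `ξ` on the open set `U`, equipped with the two-form `Ω` and the one-form `b`, is
(pre-)Hamiltonian: `ξ ⌟ Ω = d^b f` for some `f ∈ C^∞(U)`. -/
def IsHamiltonianVFOn (Ω : Form I M 2) (b : Form I M 1) (U : Set M)
    (ξ : (x : M) → TangentSpace I x) : Prop :=
  SmoothVFOn ξ U ∧ ∃ f : M → ℝ, ContMDiffOn I 𝓘(ℝ, ℝ) ∞ f U ∧ ∀ x ∈ U,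
    Ω.interior ξ x = Form.twistedD b (Form.ofFun f) x

end Forms

/-! ### Locally conformal pre-symplectic manifolds -/

section LCPS

variable {E : Type*} [NormedAddCommGroup E] [NormedSpace ℝ E]
  {H : Type*} [TopologicalSpace H] (I : ModelWithCorners ℝ E H)
  (M : Type*) [TopologicalSpace M] [ChartedSpace H M]

/-- A locally conformal pre-symplectic structure `(ω, b)` on `M`: a closed one-form `b` and a two-form
`ω` of constant rank (equivalently, whose null spaces have constant dimension `corank`)
with `d^b ω = dω + b ∧ ω = 0`. -/
structure LCPS where
  form : Form I M 2
  b : Form I M 1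
  form_smooth : form.SmoothOn univ
  b_smooth : b.SmoothOn univ
  b_closed : b.d = 0
  form_closed : Form.twistedD b form = 0
  corank : ℕ
  finrank_nullSpace : ∀ x, Module.finrank ℝ (form.nullSpace x) = corank

end LCPS

/-! ### The characteristic distribution as a smooth vector bundle -/

section CharBundle

theorem exists_splitting_data {E W : Type*} [NormedAddCommGroup E] [NormedSpace ℝ E]
    [FiniteDimensional ℝ E] [NormedAddCommGroup W] [NormedSpace ℝ W] [FiniteDimensional ℝ W]
    (A : E →L[ℝ] W) (r : ℕ) (hr : Module.finrank ℝ (A : E →ₗ[ℝ] W).ker = r) :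
    ∃ d : (W →L[ℝ] E) × (EuclideanSpace ℝ (Fin r) →L[ℝ] E) × (E →L[ℝ] EuclideanSpace ℝ (Fin r)),
      d.1 ∘L A + d.2.1 ∘L d.2.2 = ContinuousLinearMap.id ℝ E ∧
      d.2.2 ∘L d.2.1 = ContinuousLinearMap.id ℝ _ := by
  set N := (A : E →ₗ[ℝ] W).ker with hN
  have hrk : Module.finrank ℝ (EuclideanSpace ℝ (Fin r)) = Module.finrank ℝ N := by simp [hr]
  let e : EuclideanSpace ℝ (Fin r) ≃ₗ[ℝ] N := LinearEquiv.ofFinrankEq _ _ hrk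
  obtain ⟨q, hq⟩ := N.subtype.exists_leftInverse_of_injective N.ker_subtype
  let p : E →ₗ[ℝ] EuclideanSpace ℝ (Fin r) := e.symm.toLinearMap ∘ₗ q
  let i : EuclideanSpace ℝ (Fin r) →ₗ[ℝ] E := N.subtype ∘ₗ e.toLinearMap
  have hqn : ∀ n : N, q n = n := fun n => LinearMap.congr_fun hq n
  have hpi : ∀ k, p (i k) = k := fun k => by simp [p, i, hqn]
  have hAi : ∀ k, A (i k) = 0 := fun k => (e k).2
  have hinj : LinearMap.ker ((A : E →ₗ[ℝ] W).prod p) = ⊥ := by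
    rw [LinearMap.ker_eq_bot']
    intro v hv
    have h1 : A v = 0 := congrArg Prod.fst hv
    have h2 : p v = 0 := congrArg Prod.snd hv
    have h3 : q (⟨v, h1⟩ : N) = 0 := by simpa [p] using h2
    rw [hqn] at h3
    exact congrArg Subtype.val h3
  obtain ⟨L, hL⟩ := ((A : E →ₗ[ℝ] W).prod p).exists_leftInverse_of_injective hinj
  have hL' : ∀ v, L (A v, p v) = v := fun v => LinearMap.congr_fun hL v
  refine ⟨⟨LinearMap.toContinuousLinearMap (L ∘ₗ LinearMap.inl ℝ _ _),
    LinearMap.toContinuousLinearMap i, LinearMap.toContinuousLinearMap p⟩, ?_, ?_⟩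
  · ext v
    have h1 : L (0, p v) = i (p v) := by
      have := hL' (i (p v))
      rwa [hAi, hpi] at this
    have h2 := hL' v
    have h3 : ((A v, p v) : W × EuclideanSpace ℝ (Fin r)) = (A v, 0) + (0, p v) := by simp
    rw [h3, map_add, h1] at h2
    simpa using h2
  · ext1 k
    exact hpi k

variable {E : Type*} [NormedAddCommGroup E] [NormedSpace ℝ E] [FiniteDimensional ℝ E]
  {H : Type*} [TopologicalSpace H] {I : ModelWithCorners ℝ E H}
  {M : Type*} [TopologicalSpace M] [ChartedSpace H M]


theorem finiteDimensional_oneForm : FiniteDimensional ℝ (E [⋀^Fin 1]→L[ℝ] ℝ) := by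
  let T : (E [⋀^Fin 1]→L[ℝ] ℝ) →ₗ[ℝ] Module.Dual ℝ E :=
    { toFun := fun f => ((ContinuousAlternatingMap.ofSubsingleton ℝ E ℝ (0 : Fin 1)).symm f).toLinearMap
      map_add' := fun _ _ => rfl
      map_smul' := fun _ _ => rfl }
  refine Module.Finite.of_injective T fun f g h => ?_
  apply (ContinuousAlternatingMap.ofSubsingleton ℝ E ℝ (0 : Fin 1)).symm.injective
  ext v
  exact LinearMap.congr_fun h v

instance (x : M) : FiniteDimensional ℝ (TangentSpace I x) := inferInstanceAs (FiniteDimensional ℝ E)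

instance (x : M) : T2Space (TangentSpace I x) := inferInstanceAs (T2Space E)

variable [IsManifold I ∞ M] [I.Boundaryless]

theorem Form.inChart_eq {k : ℕ} (η : Form I M k) (x₀ : M) {x : M} (hx : x ∈ (chartAt H x₀).source) :
    η.inChart x₀ (extChartAt I x₀ x) =
      (η x).compContinuousLinearMap ((trivializationAt E (TangentSpace I) x₀).symmL ℝ x) := by
  have : IsManifold I 1 M := IsManifold.of_le (n := ∞) (by simp)
  rw [TangentBundle.symmL_trivializationAt hx, I.range_eq_univ, mfderivWithin_univ, Form.inChart]
  have h : (extChartAt I x₀).symm (extChartAt I x₀ x) = x :=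
    (extChartAt I x₀).left_inv (by rwa [extChartAt_source])
  rw [h]

variable (S : LCPS I M)

namespace LCPS

/-- The form `ω`, seen in the preferred chart at `x₀` as a map from vectors to covectors. -/
def flatInChart (x₀ x : M) : E →L[ℝ] E [⋀^Fin 1]→L[ℝ] ℝ :=
  (S.form.inChart x₀ (extChartAt I x₀ x)).curryLeft

theorem flatInChart_apply (x₀ : M) {x : M} (hx : x ∈ (chartAt H x₀).source) (u : E)
    (w : Fin 1 → E) :
    S.flatInChart x₀ x u w =
      S.form x ![(trivializationAt E (TangentSpace I) x₀).symmL ℝ x u,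
        (trivializationAt E (TangentSpace I) x₀).symmL ℝ x (w 0)] := by
  rw [flatInChart, Form.inChart_eq _ x₀ hx]
  change S.form x _ = _
  congr 1
  ext j
  fin_cases j <;> rfl

theorem flatInChart_eq_zero (x₀ : M) {x : M} (hx : x ∈ (chartAt H x₀).source) (u : E) :
    S.flatInChart x₀ x u = 0 ↔
      (trivializationAt E (TangentSpace I) x₀).symmL ℝ x u ∈ S.form.nullSpace x := by
  have hb : x ∈ (trivializationAt E (TangentSpace I) x₀).baseSet := hx
  rw [Form.mem_nullSpace]
  constructor
  · intro h w
    have h1 := S.flatInChart_apply x₀ hx u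
      ![(trivializationAt E (TangentSpace I) x₀).continuousLinearMapAt ℝ x w]
    rw [h] at h1
    simp only [Matrix.cons_val_zero] at h1
    rw [(trivializationAt E (TangentSpace I) x₀).symmL_continuousLinearMapAt hb] at h1
    exact h1.symm
  · intro h
    ext w
    rw [S.flatInChart_apply x₀ hx, h]
    rfl

theorem finrank_ker_flat (x₀ : M) :
    Module.finrank ℝ (S.flatInChart x₀ x₀ : E →ₗ[ℝ] E [⋀^Fin 1]→L[ℝ] ℝ).ker = S.corank := by
  have hx := mem_chart_source H x₀
  have hb : x₀ ∈ (trivializationAt E (TangentSpace I) x₀).baseSet := hx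
  rw [← S.finrank_nullSpace x₀]
  refine LinearEquiv.finrank_eq ?_
  refine ((trivializationAt E (TangentSpace I) x₀).continuousLinearEquivAt ℝ x₀
    hb).symm.toLinearEquiv.ofSubmodules _ _ ?_
  ext v
  constructor
  · rintro ⟨u, hu, rfl⟩
    change (trivializationAt E (TangentSpace I) x₀).toPretrivialization.symm x₀ u ∈ _
    change S.flatInChart x₀ x₀ u = 0 at hu
    have h := (S.flatInChart_eq_zero x₀ hx u).mp hu
    rw [(trivializationAt E (TangentSpace I) x₀).symmL_apply hb] at h
    exact h
  · intro hv
    refine ⟨(trivializationAt E (TangentSpace I) x₀).continuousLinearMapAt ℝ x₀ v, ?_, ?_⟩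
    · refine (S.flatInChart_eq_zero x₀ hx _).mpr ?_
      rwa [(trivializationAt E (TangentSpace I) x₀).symmL_continuousLinearMapAt hb]
    · have h := (trivializationAt E (TangentSpace I) x₀).symmL_continuousLinearMapAt (R := ℝ) hb v
      rw [(trivializationAt E (TangentSpace I) x₀).symmL_apply hb] at h
      exact h

theorem exists_data (x₀ : M) :
    ∃ d : ((E [⋀^Fin 1]→L[ℝ] ℝ) →L[ℝ] E) × (EuclideanSpace ℝ (Fin S.corank) →L[ℝ] E) ×
        (E →L[ℝ] EuclideanSpace ℝ (Fin S.corank)),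
      d.1 ∘L S.flatInChart x₀ x₀ + d.2.1 ∘L d.2.2 = ContinuousLinearMap.id ℝ E ∧
      d.2.2 ∘L d.2.1 = ContinuousLinearMap.id ℝ _ :=
  haveI := finiteDimensional_oneForm (E := E)
  exists_splitting_data _ _ (S.finrank_ker_flat x₀)

/-- A left inverse of `ω : E → E*` at `x₀`, up to the projection to its kernel. -/
def locQ (x₀ : M) : (E [⋀^Fin 1]→L[ℝ] ℝ) →L[ℝ] E := (S.exists_data x₀).choose.1
/-- A basis of the kernel of `ω` at `x₀`. -/
def locI (x₀ : M) : EuclideanSpace ℝ (Fin S.corank) →L[ℝ] E := (S.exists_data x₀).choose.2.1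
/-- A projection to the kernel of `ω` at `x₀`, in coordinates. -/
def locP (x₀ : M) : E →L[ℝ] EuclideanSpace ℝ (Fin S.corank) := (S.exists_data x₀).choose.2.2

/-- The map `Q ∘ ω + i ∘ p`, which is the identity at `x₀`. -/
def locPhi (x₀ x : M) : E →L[ℝ] E :=
  S.locQ x₀ ∘L S.flatInChart x₀ x + S.locI x₀ ∘L S.locP x₀

theorem locPhi_self (x₀ : M) : S.locPhi x₀ x₀ = 1 := (S.exists_data x₀).choose_spec.1

theorem locP_locI (x₀ : M) (k) : S.locP x₀ (S.locI x₀ k) = k :=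
  DFunLike.congr_fun (S.exists_data x₀).choose_spec.2 k

theorem contMDiffOn_locPhi (x₀ : M) :
    ContMDiffOn I 𝓘(ℝ, E →L[ℝ] E) ∞ (S.locPhi x₀) (chartAt H x₀).source := by
  have h1 : ContMDiffOn I 𝓘(ℝ, E [⋀^Fin 2]→L[ℝ] ℝ) ∞
      (fun x => S.form.inChart x₀ (extChartAt I x₀ x)) (chartAt H x₀).source := by
    have h3 : ContMDiffOn 𝓘(ℝ, E) 𝓘(ℝ, E [⋀^Fin 2]→L[ℝ] ℝ) ∞ (S.form.inChart x₀)
        (extChartAt I x₀).target := by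
      have := S.form_smooth x₀
      rw [preimage_univ, inter_univ] at this
      exact this.contMDiffOn
    have h4 : ContMDiffOn I 𝓘(ℝ, E) ∞ (extChartAt I x₀) (chartAt H x₀).source :=
      contMDiffOn_extChartAt
    exact h3.comp h4 fun x hx => (extChartAt I x₀).map_source (by rwa [extChartAt_source])
  have h2 : ContMDiffOn I 𝓘(ℝ, E →L[ℝ] E [⋀^Fin 1]→L[ℝ] ℝ) ∞ (S.flatInChart x₀)
      (chartAt H x₀).source := by
    let L : (E [⋀^Fin 2]→L[ℝ] ℝ) →ₗᵢ[ℝ] E →L[ℝ] E [⋀^Fin 1]→L[ℝ] ℝ :=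
      ContinuousAlternatingMap.curryLeftLI
    have h : ContDiff ℝ ∞ L.toContinuousLinearMap := ContinuousLinearMap.contDiff _
    exact h.contMDiff.comp_contMDiffOn h1
  exact (contMDiffOn_const.clm_comp h2).add contMDiffOn_const

/-- The domain of the local trivialization at `x₀`. -/
def locBase (x₀ : M) : Set M := (chartAt H x₀).source ∩ {x | IsUnit (S.locPhi x₀ x)}

theorem isOpen_locBase (x₀ : M) : IsOpen (S.locBase x₀) :=
  (S.contMDiffOn_locPhi x₀).continuousOn.isOpen_inter_preimage (chartAt H x₀).open_source
    Units.isOpen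

theorem mem_locBase (x₀ : M) : x₀ ∈ S.locBase x₀ :=
  ⟨mem_chart_source H x₀, by simp [S.locPhi_self]⟩

/-- The fibre `E_x = (T_x M)^ω` of the characteristic distribution `E = (TM)^ω`. -/
def Char (x : M) : Type _ := S.form.nullSpace x
deriving AddCommGroup, Module ℝ, TopologicalSpace, IsTopologicalAddGroup, ContinuousSMul ℝ

instance (x : M) : FiniteDimensional ℝ (S.Char x) :=
  inferInstanceAs (FiniteDimensional ℝ (S.form.nullSpace x))

instance (x : M) : T2Space (S.Char x) :=
  inferInstanceAs (T2Space (S.form.nullSpace x))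

/-- The inclusion `E_x → T_x M`. -/
def incl (x : M) : S.Char x →L[ℝ] TangentSpace I x := (S.form.nullSpace x).subtypeL

theorem locP_eq (x₀ : M) {x : M} (hx : x ∈ (chartAt H x₀).source) (v : S.Char x) :
    S.locPhi x₀ x ((trivializationAt E (TangentSpace I) x₀).continuousLinearMapAt ℝ x (S.incl x v)) =
      S.locI x₀ (S.locP x₀
        ((trivializationAt E (TangentSpace I) x₀).continuousLinearMapAt ℝ x (S.incl x v))) := by
  have hb : x ∈ (trivializationAt E (TangentSpace I) x₀).baseSet := hx
  have h : S.flatInChart x₀ x ((trivializationAt E (TangentSpace I) x₀).continuousLinearMapAt ℝ x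
      (S.incl x v)) = 0 := by
    rw [S.flatInChart_eq_zero x₀ hx,
      (trivializationAt E (TangentSpace I) x₀).symmL_continuousLinearMapAt hb]
    exact v.2
  simp [locPhi, -Trivialization.continuousLinearMapAt_apply, h]

/-- The local trivialization at `x₀`, on the fibre over `x`: the expression of a vector in the
preferred chart at `x₀`, followed by the projection to the kernel of `ω` at `x₀`. -/
def fibreEquiv (x₀ : M) {x : M} (hx : x ∈ S.locBase x₀) :
    S.Char x ≃L[ℝ] EuclideanSpace ℝ (Fin S.corank) :=
  let f : S.Char x →L[ℝ] EuclideanSpace ℝ (Fin S.corank) :=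
    S.locP x₀ ∘L (trivializationAt E (TangentSpace I) x₀).continuousLinearMapAt ℝ x ∘L S.incl x
  have hinj : Function.Injective f := by
    rw [injective_iff_map_eq_zero]
    intro v hv
    have hb : x ∈ (trivializationAt E (TangentSpace I) x₀).baseSet := hx.1
    have h1 := S.locP_eq x₀ hx.1 v
    change S.locP x₀ ((trivializationAt E (TangentSpace I) x₀).continuousLinearMapAt ℝ x
      (S.incl x v)) = 0 at hv
    rw [hv, map_zero] at h1
    obtain ⟨u, hu⟩ := hx.2
    have h2 : (trivializationAt E (TangentSpace I) x₀).continuousLinearMapAt ℝ x (S.incl x v) = 0 := by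
      rw [← hu] at h1
      have := congrArg (fun w => (↑u⁻¹ : E →L[ℝ] E) w) h1
      simpa [← mul_apply_eq_comp] using this
    have h3 := (trivializationAt E (TangentSpace I) x₀).symmL_continuousLinearMapAt (R := ℝ) hb
      (S.incl x v)
    rw [h2, map_zero] at h3
    exact Subtype.ext h3.symm
  have hrk : Module.finrank ℝ (S.Char x) =
      Module.finrank ℝ (EuclideanSpace ℝ (Fin S.corank)) := by
    rw [finrank_euclideanSpace_fin]
    exact S.finrank_nullSpace x
  (LinearEquiv.ofBijective (f : S.Char x →ₗ[ℝ] _)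
    ⟨hinj, (LinearMap.injective_iff_surjective_of_finrank_eq_finrank hrk).mp
      hinj⟩).toContinuousLinearEquiv

theorem fibreEquiv_apply (x₀ : M) {x : M} (hx : x ∈ S.locBase x₀) (v : S.Char x) :
    S.fibreEquiv x₀ hx v = S.locP x₀
      ((trivializationAt E (TangentSpace I) x₀).continuousLinearMapAt ℝ x (S.incl x v)) := rfl

theorem incl_fibreEquiv_symm (x₀ : M) {x : M} (hx : x ∈ S.locBase x₀) (k) :
    (trivializationAt E (TangentSpace I) x₀).continuousLinearMapAt ℝ x
      (S.incl x ((S.fibreEquiv x₀ hx).symm k)) = Ring.inverse (S.locPhi x₀ x) (S.locI x₀ k) := by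
  have h1 := S.locP_eq x₀ hx.1 ((S.fibreEquiv x₀ hx).symm k)
  rw [← S.fibreEquiv_apply x₀ hx, ContinuousLinearEquiv.apply_symm_apply] at h1
  rw [← h1, ← mul_apply_eq_comp, Ring.inverse_mul_cancel _ hx.2]
  rfl

open Classical in
/-- The local trivializations of the characteristic distribution. -/
def pretriv (x₀ : M) : Pretrivialization (EuclideanSpace ℝ (Fin S.corank))
    (π (EuclideanSpace ℝ (Fin S.corank)) S.Char) where
  toFun v := (v.1, S.locP x₀
    ((trivializationAt E (TangentSpace I) x₀).continuousLinearMapAt ℝ v.1 (S.incl v.1 v.2)))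
  invFun w := ⟨w.1, if h : w.1 ∈ S.locBase x₀ then (S.fibreEquiv x₀ h).symm w.2 else 0⟩
  source := TotalSpace.proj ⁻¹' S.locBase x₀
  target := S.locBase x₀ ×ˢ univ
  map_source' _ h := ⟨h, mem_univ _⟩
  map_target' _ h := h.1
  left_inv' := by
    rintro ⟨x, v⟩ (hx : x ∈ S.locBase x₀)
    simp only [hx, dif_pos, TotalSpace.mk_inj]
    rw [← S.fibreEquiv_apply x₀ hx, ContinuousLinearEquiv.symm_apply_apply]
  right_inv' := by
    rintro ⟨x, k⟩ ⟨hx : x ∈ S.locBase x₀, -⟩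
    simp only [hx, dif_pos, Prod.mk_right_inj]
    rw [← S.fibreEquiv_apply x₀ hx, ContinuousLinearEquiv.apply_symm_apply]
  open_target := (S.isOpen_locBase x₀).prod isOpen_univ
  baseSet := S.locBase x₀
  open_baseSet := S.isOpen_locBase x₀
  source_eq := rfl
  target_eq := rfl
  proj_toFun _ _ := rfl

theorem pretriv_apply (x₀ : M) (v) : S.pretriv x₀ v = (v.1, S.locP x₀
    ((trivializationAt E (TangentSpace I) x₀).continuousLinearMapAt ℝ v.1 (S.incl v.1 v.2))) := rfl

theorem pretriv_symm (x₀ : M) {x : M} (hx : x ∈ S.locBase x₀) (k) :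
    (S.pretriv x₀).symm x k = (S.fibreEquiv x₀ hx).symm k := by
  apply (S.fibreEquiv x₀ hx).injective
  rw [ContinuousLinearEquiv.apply_symm_apply, S.fibreEquiv_apply]
  have := (S.pretriv x₀).apply_mk_symm (b := x) hx k
  rw [pretriv_apply] at this
  exact congrArg Prod.snd this

theorem exists_coordChange (x₀ x₁ : M) :
    ∃ f : M → EuclideanSpace ℝ (Fin S.corank) →L[ℝ] EuclideanSpace ℝ (Fin S.corank),
      ContMDiffOn I 𝓘(ℝ, EuclideanSpace ℝ (Fin S.corank) →L[ℝ] EuclideanSpace ℝ (Fin S.corank)) ∞ f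
        (S.locBase x₀ ∩ S.locBase x₁) ∧
      ∀ x ∈ S.locBase x₀ ∩ S.locBase x₁, ∀ k,
        f x k = (S.pretriv x₁ ⟨x, (S.pretriv x₀).symm x k⟩).2 := by
  let T (y : M) := trivializationAt E (TangentSpace I) y
  refine ⟨fun x => S.locP x₁ ∘L ((T x₀).coordChangeL ℝ (T x₁) x : E →L[ℝ] E) ∘L
    Ring.inverse (S.locPhi x₀ x) ∘L S.locI x₀, ?_, ?_⟩
  · refine contMDiffOn_const.clm_comp (ContMDiffOn.clm_comp ?_ (ContMDiffOn.clm_comp ?_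
      contMDiffOn_const))
    · exact (contMDiffOn_coordChangeL (IB := I) (n := ∞) (T x₀) (T x₁)).mono
        fun x hx => ⟨hx.1.1, hx.2.1⟩
    · intro x hx
      obtain ⟨u, hu⟩ := hx.1.2
      have h1 : ContDiffAt ℝ ∞ Ring.inverse (S.locPhi x₀ x) := by
        rw [← hu]
        exact contDiffAt_ringInverse ℝ u
      exact h1.contMDiffAt.comp_contMDiffWithinAt x
        ((S.contMDiffOn_locPhi x₀ x hx.1.1).mono fun y hy => hy.1.1)
  · intro x hx k
    have h0 : x ∈ (T x₀).baseSet := hx.1.1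
    have h1 : x ∈ (T x₁).baseSet := hx.2.1
    rw [S.pretriv_symm x₀ hx.1, S.pretriv_apply]
    simp only [ContinuousLinearMap.comp_apply]
    rw [← S.incl_fibreEquiv_symm x₀ hx.1]
    congr 1
    change (T x₀).coordChangeL ℝ (T x₁) x ((T x₀).continuousLinearMapAt ℝ x _) =
      (T x₁).continuousLinearMapAt ℝ x _
    rw [(T x₀).coordChangeL_apply (T x₁) ⟨h0, h1⟩, ← (T x₀).symmL_apply (R := ℝ) h0,
      (T x₀).symmL_continuousLinearMapAt h0, (T x₁).continuousLinearMapAt_apply_of_mem ℝ h1]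

/-- The characteristic distribution `E = (TM)^ω` as a vector bundle (auxiliary construction). -/
def prebundle : VectorPrebundle ℝ (EuclideanSpace ℝ (Fin S.corank)) S.Char where
  pretrivializationAtlas := range S.pretriv
  pretrivialization_linear' := by
    rintro _ ⟨x₀, rfl⟩
    exact ⟨fun x _ => ⟨fun v w => by simp [pretriv_apply], fun c v => by simp [pretriv_apply]⟩⟩
  pretrivializationAt := S.pretriv
  mem_base_pretrivializationAt := S.mem_locBase
  pretrivialization_mem_atlas x := ⟨x, rfl⟩
  exists_coordChange := by
    rintro _ ⟨x₀, rfl⟩ _ ⟨x₁, rfl⟩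
    obtain ⟨f, hf, h⟩ := S.exists_coordChange x₀ x₁
    exact ⟨f, hf.continuousOn, h⟩
  totalSpaceMk_isInducing x :=
    Topology.isInducing_const_prod.mpr (S.fibreEquiv x (S.mem_locBase x)).toHomeomorph.isInducing

instance : S.prebundle.IsContMDiff I ∞ where
  exists_contMDiffCoordChange := by
    rintro _ ⟨x₀, rfl⟩ _ ⟨x₁, rfl⟩
    exact S.exists_coordChange x₀ x₁

instance : TopologicalSpace (TotalSpace (EuclideanSpace ℝ (Fin S.corank)) S.Char) :=
  S.prebundle.totalSpaceTopology

instance : FiberBundle (EuclideanSpace ℝ (Fin S.corank)) S.Char := S.prebundle.toFiberBundle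

instance : VectorBundle ℝ (EuclideanSpace ℝ (Fin S.corank)) S.Char := S.prebundle.toVectorBundle

instance : ContMDiffVectorBundle ∞ (EuclideanSpace ℝ (Fin S.corank)) S.Char I :=
  S.prebundle.contMDiffVectorBundle I

end LCPS

end CharBundle

/-! ### The thickening -/

section Thickening

variable {E : Type*} [NormedAddCommGroup E] [NormedSpace ℝ E] [FiniteDimensional ℝ E]
  {H : Type*} [TopologicalSpace H] {I : ModelWithCorners ℝ E H} [I.Boundaryless]
  {M : Type*} [TopologicalSpace M] [ChartedSpace H M] [IsManifold I ∞ M]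

/-- The pull-back of a form under a map of manifolds. -/
def Form.pullback {E' : Type*} [NormedAddCommGroup E'] [NormedSpace ℝ E']
    {H' : Type*} [TopologicalSpace H'] {I' : ModelWithCorners ℝ E' H'}
    {M' : Type*} [TopologicalSpace M'] [ChartedSpace H' M'] {k : ℕ}
    (φ : M' → M) (η : Form I M k) : Form I' M' k := fun x =>
  (η (φ x)).compContinuousLinearMap (mfderiv I' I φ x)

namespace LCPS

variable (S : LCPS I M)

/-- A splitting `TM = G ⊕ E` of the tangent bundle into a smooth subbundle `G` and the characteristic
distribution `E`; smoothness of `G` is expressed as smoothness of the projection to `E` along `G`. -/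
structure Splitting where
  G : (x : M) → Submodule ℝ (TangentSpace I x)
  isCompl : ∀ x, IsCompl (S.form.nullSpace x) (G x)
  smooth_proj : ContMDiff I (I.prod 𝓘(ℝ, E →L[ℝ] E)) ∞
    (fun x => (⟨x, LinearMap.toContinuousLinearMap ((S.form.nullSpace x).projection (G x) (isCompl x))⟩ :
      TotalSpace (E →L[ℝ] E) (fun x : M => TangentSpace I x →L[ℝ] TangentSpace I x)))

/-- The projection `p_G : T_x M → E_x` along `G_x`. -/
def Splitting.proj {S : LCPS I M} (P : S.Splitting) (x : M) : TangentSpace I x →L[ℝ] S.Char x :=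
  LinearMap.toContinuousLinearMap
    ((S.form.nullSpace x).projectionOnto (P.G x) (P.isCompl x))

/-- The model fibre of the dual bundle `E*`. -/
abbrev DualFibre : Type := EuclideanSpace ℝ (Fin S.corank) →L[ℝ] ℝ

/-- The total space of the vector bundle `E*` dual to the characteristic distribution. -/
abbrev CharDual : Type _ :=
  TotalSpace S.DualFibre (fun x : M => S.Char x →L[ℝ] Trivial M ℝ x)

/-- The model with corners of the manifold `E*`. -/
abbrev dualModel : ModelWithCorners ℝ (E × S.DualFibre) (ModelProd H S.DualFibre) :=
  I.prod 𝓘(ℝ, S.DualFibre)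

/-- The bundle projection `π : E* → M`. -/
def dualProj : S.CharDual → M := TotalSpace.proj

/-- The zero section `M → E*`. -/
def zeroSec (x : M) : S.CharDual := ⟨x, 0⟩

variable {S}

/-- The canonical one-form `θ_G` on `E*`: `θ_G (ξ) = α (p_G (Tπ ξ))` for `ξ ∈ T_α E*`. -/
def Splitting.theta (P : S.Splitting) : Form S.dualModel S.CharDual 1 := fun α =>
  let c : TangentSpace I (S.dualProj α) →L[ℝ] ℝ := ContinuousLinearMap.comp α.2 (P.proj α.1)
  ContinuousAlternatingMap.ofSubsingleton ℝ (TangentSpace S.dualModel α) ℝ (0 : Fin 1)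
    (c ∘L mfderiv S.dualModel I S.dualProj α)

variable (S) in
/-- The one-form `π* b` on `E*`. -/
def bDual : Form S.dualModel S.CharDual 1 := S.b.pullback S.dualProj

/-- The two-form `ω_G = π* ω - dθ_G - π* b ∧ θ_G` on `E*`. -/
def Splitting.formG (P : S.Splitting) : Form S.dualModel S.CharDual 2 :=
  S.form.pullback S.dualProj - P.theta.d - S.bDual.wedge P.theta

/-- `U` is the domain of a thickening: an open neighbourhood of the zero section of `E*` on which `ω_G`
is non-degenerate. -/
structure Splitting.IsThickening (P : S.Splitting) (U : Set S.CharDual) : Prop where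
  isOpen : IsOpen U
  zeroSec_mem : ∀ x, S.zeroSec x ∈ U
  nondegenerate : ∀ α ∈ U, P.formG.nullSpace α = ⊥

variable (S) in
/-- The vector field `X` on a neighbourhood of the zero section of `E*` extends the vector field `ξ`
on `M`, where `M` is identified with the zero section. -/
def Extends (X : (α : S.CharDual) → TangentSpace S.dualModel α) (ξ : (x : M) → TangentSpace I x) :
    Prop :=
  ∀ x, X (S.zeroSec x) = mfderiv I S.dualModel S.zeroSec x (ξ x)

end LCPS

end Thickening

end LCS

end

open LCS

noncomputable section
namespace LCS

section ModelSpace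

open ContinuousAlternatingMap

variable {V : Type*} [NormedAddCommGroup V] [NormedSpace ℝ V]
  {W : Type*} [NormedAddCommGroup W] [NormedSpace ℝ W] {k : ℕ}

/-- The wedge product with a covector as a continuous bilinear map. -/
def wedgeL (V : Type*) [NormedAddCommGroup V] [NormedSpace ℝ V] (k : ℕ) :
    (V [⋀^Fin 1]→L[ℝ] ℝ) →L[ℝ] (V [⋀^Fin k]→L[ℝ] ℝ) →L[ℝ] V [⋀^Fin (k + 1)]→L[ℝ] ℝ :=
  (ContinuousLinearMap.compL ℝ (V [⋀^Fin k]→L[ℝ] ℝ) (V →L[ℝ] V [⋀^Fin k]→L[ℝ] ℝ)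
      (V [⋀^Fin (k + 1)]→L[ℝ] ℝ) (alternatizeUncurryFinCLM ℝ V ℝ)) ∘L
    (ContinuousLinearMap.smulRightL ℝ V (V [⋀^Fin k]→L[ℝ] ℝ)) ∘L
    ((ofSubsingletonLIE (𝕜 := ℝ) (E := V) (F := ℝ) (0 : Fin 1)).symm.toContinuousLinearEquiv :
      (V [⋀^Fin 1]→L[ℝ] ℝ) →L[ℝ] V →L[ℝ] ℝ)

theorem ofSubsingleton_symm_apply (β : V [⋀^Fin 1]→L[ℝ] ℝ) (v : V) :
    (ContinuousAlternatingMap.ofSubsingleton ℝ V ℝ (0 : Fin 1)).symm β v = β ![v] := by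
  have h : ![v] = fun _ : Fin 1 => v := by ext j; fin_cases j; rfl
  rw [h]
  rfl

theorem wedge_compContinuousLinearMap (β : W [⋀^Fin 1]→L[ℝ] ℝ) (η : W [⋀^Fin k]→L[ℝ] ℝ)
    (g : V →L[ℝ] W) : (wedge β η).compContinuousLinearMap g =
      wedge (β.compContinuousLinearMap g) (η.compContinuousLinearMap g) := by
  ext v
  rw [wedge_apply, compContinuousLinearMap_apply, wedge_apply]
  refine Finset.sum_congr rfl fun i _ => ?_
  congr 2
  rw [compContinuousLinearMap_apply]
  congr 1
  ext j
  fin_cases j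
  rfl

theorem wedge_wedge_self (β : V [⋀^Fin 1]→L[ℝ] ℝ) (η : V [⋀^Fin k]→L[ℝ] ℝ) :
    wedge β (wedge β η) = 0 := by
  let b := (ContinuousAlternatingMap.ofSubsingleton ℝ V ℝ (0 : Fin 1)).symm β
  have h : wedge β (wedge β η) = alternatizeUncurryFin (alternatizeUncurryFinCLM ℝ V ℝ ∘L
      (b.smulRight (b.smulRight η))) := by
    unfold wedge
    congr 1
    ext1 v
    simp [b]
  rw [h]
  apply alternatizeUncurryFin_alternatizeUncurryFinCLM_comp_of_symmetric
  intro x y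
  simp [smul_smul, mul_comm]

theorem fderiv_symm_of_extDeriv_eq_zero {β : V → V [⋀^Fin 1]→L[ℝ] ℝ} {z : V}
    (h : extDeriv β z = 0) (v w : V) : fderiv ℝ β z v ![w] = fderiv ℝ β z w ![v] := by
  have h1 : extDeriv β z ![v, w] = 0 := by rw [h]; rfl
  have e0 : Fin.removeNth (0 : Fin 2) ![v, w] = ![w] := by ext j; fin_cases j; rfl
  have e1 : Fin.removeNth (1 : Fin 2) ![v, w] = ![v] := by ext j; fin_cases j; rfl
  rw [extDeriv, alternatizeUncurryFin_apply, Fin.sum_univ_two, e0, e1] at h1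
  simp at h1
  linarith

theorem extDeriv_wedge_of_closed {β : V → V [⋀^Fin 1]→L[ℝ] ℝ} {η : V → V [⋀^Fin k]→L[ℝ] ℝ} {z : V}
    (hβ : DifferentiableAt ℝ β z) (hη : DifferentiableAt ℝ η z) (h : extDeriv β z = 0) :
    extDeriv (fun y => wedge (β y) (η y)) z = -wedge (β z) (extDeriv η z) := by
  have hd : fderiv ℝ (fun y => wedge (β y) (η y)) z =
      (wedgeL V k (β z)) ∘L (fderiv ℝ η z) + ((wedgeL V k).flip (η z)) ∘L (fderiv ℝ β z) := by
    have := (wedgeL V k).hasFDerivAt_of_bilinear hβ.hasFDerivAt hη.hasFDerivAt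
    refine this.fderiv.trans ?_
    ext v
    rfl
  rw [eq_neg_iff_add_eq_zero]
  let T := ((ofSubsingletonLIE (𝕜 := ℝ) (E := V) (F := ℝ) (0 : Fin 1)).symm.toContinuousLinearEquiv :
      (V [⋀^Fin 1]→L[ℝ] ℝ) →L[ℝ] V →L[ℝ] ℝ)
  have hT : ∀ γ v, T γ v = γ ![v] := fun γ v => ofSubsingleton_symm_apply γ v
  let R := ContinuousLinearMap.smulRightL ℝ V (V [⋀^Fin k]→L[ℝ] ℝ)
  let F : V →L[ℝ] V →L[ℝ] V [⋀^Fin k]→L[ℝ] ℝ :=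
    (R (T (β z))) ∘L (fderiv ℝ η z) + (R.flip (η z)) ∘L T ∘L (fderiv ℝ β z) +
      (T (β z)).smulRight (fderiv ℝ η z)
  have h2 : extDeriv (fun y => wedge (β y) (η y)) z + wedge (β z) (extDeriv η z) =
      alternatizeUncurryFin (alternatizeUncurryFinCLM ℝ V ℝ ∘L F) := by
    rw [extDeriv, hd, wedge, ← alternatizeUncurryFin_add]
    congr 1
    ext1 v
    simp only [F, _root_.add_apply, ContinuousLinearMap.comp_apply, map_add]
    congr 1
    simp only [ContinuousLinearMap.smulRight_apply, map_smul]
    rfl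
  rw [h2]
  apply alternatizeUncurryFin_alternatizeUncurryFinCLM_comp_of_symmetric
  intro x y
  simp only [F, R, _root_.add_apply, ContinuousLinearMap.comp_apply,
    ContinuousLinearMap.smulRightL_apply_apply, ContinuousLinearMap.flip_apply, hT,
    ContinuousLinearMap.smulRight_apply, fderiv_symm_of_extDeriv_eq_zero h x y, 
    _root_.smul_apply]
  abel

theorem extDeriv_smul_of_fderiv_eq_zero {c : V → ℝ} {η : V → V [⋀^Fin k]→L[ℝ] ℝ} {z : V}
    (hc : DifferentiableAt ℝ c z) (hη : DifferentiableAt ℝ η z) (h : fderiv ℝ c z = 0) :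
    extDeriv (fun y => c y • η y) z = c z • extDeriv η z := by
  rw [extDeriv, fderiv_fun_smul hc hη, h, extDeriv, ← alternatizeUncurryFin_smul]
  congr 1
  ext v
  simp

theorem removeNth_succ_vecCons {α : Type*} (x : α) (v : Fin (k + 1) → α) (i : Fin (k + 1)) :
    Fin.removeNth i.succ (Matrix.vecCons x v) = Matrix.vecCons x (i.removeNth v) := by
  ext j
  refine Fin.cases ?_ (fun j => ?_) j <;> simp [Fin.removeNth]

theorem curryLeft_wedge (β : V [⋀^Fin 1]→L[ℝ] ℝ) (η : V [⋀^Fin (k + 1)]→L[ℝ] ℝ) (x : V) :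
    (wedge β η).curryLeft x = β ![x] • η - wedge β (η.curryLeft x) := by
  ext v
  have h0 : Fin.removeNth (0 : Fin (k + 2)) (Matrix.vecCons x v) = v := rfl
  rw [curryLeft_apply_apply, wedge_apply, Fin.sum_univ_succ, h0]
  simp only [removeNth_succ_vecCons, Matrix.cons_val_zero, Matrix.cons_val_succ, Fin.val_zero,
    Fin.val_succ, pow_zero, one_mul, pow_succ, mul_neg, mul_one, neg_mul, Finset.sum_neg_distrib]
  rw [← sub_eq_add_neg]
  congr 1
  exact (wedge_apply β (η.curryLeft x) v).symm

/-- Cartan's formula. -/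
theorem fderiv_apply_add_sum_update {η : V → V [⋀^Fin (k + 1)]→L[ℝ] ℝ} {X : V → V} {z : V}
    (hη : DifferentiableAt ℝ η z) (hX : DifferentiableAt ℝ X z) (v : Fin (k + 1) → V) :
    fderiv ℝ η z (X z) v + ∑ i, η z (Function.update v i (fderiv ℝ X z (v i))) =
      extDeriv η z (Matrix.vecCons (X z) v) + extDeriv (fun y => curryLeft (η y) (X y)) z v := by
  let L := (curryLeftLI (𝕜 := ℝ) (E := V) (F := ℝ) (n := k)).toContinuousLinearMap
  have hL : ∀ f, L f = curryLeft f := fun _ => rfl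
  have h0 : HasFDerivAt L L (η z) := ContinuousLinearMap.hasFDerivAt _
  have hd : fderiv ℝ (fun y => curryLeft (η y) (X y)) z =
      L (η z) ∘L fderiv ℝ X z + (L ∘L fderiv ℝ η z).flip (X z) := by
    have h1 := HasFDerivAt.comp (g := L) z h0 hη.hasFDerivAt
    exact (h1.clm_apply hX.hasFDerivAt).fderiv
  have hs : ∀ i : Fin (k + 1), η z (Function.update v i (fderiv ℝ X z (v i))) =
      (-1) ^ (i : ℕ) • η z (Matrix.vecCons (fderiv ℝ X z (v i)) (i.removeNth v)) := by
    intro i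
    rw [← neg_one_pow_smul_map_insertNth (p := i), ← Fin.insertNth_removeNth]
    simp [← mul_pow, ← mul_assoc]
  rw [extDeriv, extDeriv, alternatizeUncurryFin_apply, alternatizeUncurryFin_apply, hd,
    Fin.sum_univ_succ (n := k + 1)]
  simp only [hs, hL, _root_.add_apply, ContinuousLinearMap.comp_apply,
    ContinuousLinearMap.flip_apply, curryLeft_apply_apply, smul_add, Finset.sum_add_distrib,
    _root_.add_apply, ContinuousAlternatingMap.add_apply]
  have h0 : Fin.removeNth (0 : Fin (k + 2)) (Matrix.vecCons (X z) v) = v := by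
    ext j; rfl
  simp only [h0, removeNth_succ_vecCons, Matrix.cons_val_zero, Matrix.cons_val_succ, Fin.val_zero, Fin.val_succ, pow_zero,
    one_smul, pow_succ, mul_neg, mul_one, neg_smul, Finset.sum_neg_distrib]
  abel

theorem ContDiffAt.alternating_apply {n : WithTop ℕ∞} {z : W} :
    ∀ {k : ℕ} {f : W → V [⋀^Fin k]→L[ℝ] ℝ} {v : W → Fin k → V}, ContDiffAt ℝ n f z →
      ContDiffAt ℝ n v z → ContDiffAt ℝ n (fun y => f y (v y)) z
  | 0, f, v, hf, _ => by
    have h : (fun y => f y (v y)) =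
        fun y => ((constOfIsEmptyLIE ℝ V ℝ (Fin 0)).symm.toContinuousLinearEquiv :
          (V [⋀^Fin 0]→L[ℝ] ℝ) →L[ℝ] ℝ) (f y) := by
      ext y
      exact congrArg (f y) (Subsingleton.elim _ _)
    rw [h]
    exact (ContinuousLinearMap.contDiff _).contDiffAt.comp z hf
  | k + 1, f, v, hf, hv => by
    let L := (curryLeftLI (𝕜 := ℝ) (E := V) (F := ℝ) (n := k)).toContinuousLinearMap
    have h : (fun y => f y (v y)) = fun y => (L (f y) (v y 0)) (Fin.tail (v y)) := by
      ext y
      exact congrArg (f y) (Fin.cons_self_tail (v y)).symm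
    rw [h]
    have hv' := contDiffAt_pi.mp hv
    have hL : ContDiff ℝ n L := ContinuousLinearMap.contDiff _
    have hLf : ContDiffAt ℝ n (fun y => L (f y)) z := hL.contDiffAt.comp z hf
    refine ContDiffAt.alternating_apply (hLf.clm_apply (hv' 0)) (contDiffAt_pi.mpr fun i => hv' i.succ)

variable [FiniteDimensional ℝ V]

variable (V k) in
theorem exists_continuousLinear_leftInverse_eval :
    ∃ (ι : Type) (_ : Fintype ι) (e : ι → Fin k → V) (L : (ι → ℝ) →L[ℝ] V [⋀^Fin k]→L[ℝ] ℝ),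
      ∀ f : V [⋀^Fin k]→L[ℝ] ℝ, L (fun i => f (e i)) = f := by
  let B := Module.finBasis ℝ V
  let T : (V [⋀^Fin k]→L[ℝ] ℝ) →ₗ[ℝ] ((Fin k → Fin (Module.finrank ℝ V)) → ℝ) :=
    { toFun := fun f i => f fun j => B (i j)
      map_add' := fun _ _ => rfl
      map_smul' := fun _ _ => rfl }
  have hT : LinearMap.ker T = ⊥ := by
    rw [LinearMap.ker_eq_bot']
    intro f hf
    apply ContinuousAlternatingMap.toAlternatingMap_injective
    apply B.ext_alternating
    intro i _
    exact congrFun hf i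
  obtain ⟨L, hL⟩ := T.exists_leftInverse_of_injective hT
  exact ⟨Fin k → Fin (Module.finrank ℝ V), inferInstance, fun i j => B (i j), LinearMap.toContinuousLinearMap L,
    fun f => LinearMap.congr_fun hL f⟩

theorem contDiffAt_of_alternating_apply {n : WithTop ℕ∞} {f : W → V [⋀^Fin k]→L[ℝ] ℝ} {z : W}
    (h : ∀ v, ContDiffAt ℝ n (fun y => f y v) z) : ContDiffAt ℝ n f z := by
  obtain ⟨ι, _, e, L, hL⟩ := exists_continuousLinear_leftInverse_eval V k
  have h1 : f = fun y => L fun i => f y (e i) := by ext1 y; exact (hL _).symm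
  rw [h1]
  exact L.contDiff.contDiffAt.comp z (contDiffAt_pi.mpr fun i => h (e i))

theorem isInvertible_of_injective {B : V →L[ℝ] V [⋀^Fin 1]→L[ℝ] ℝ} (hB : Function.Injective B) :
    B.IsInvertible := by
  have hfin := finiteDimensional_oneForm (E := V)
  have hrk : Module.finrank ℝ V = Module.finrank ℝ (V [⋀^Fin 1]→L[ℝ] ℝ) := by
    rw [← (ofSubsingletonLIE (𝕜 := ℝ) (E := V) (F := ℝ)
      (0 : Fin 1)).toLinearEquiv.finrank_eq,
      ← (LinearMap.toContinuousLinearMap (𝕜 := ℝ) (E := V) (F' := ℝ)).finrank_eq]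
    exact Subspace.dual_finrank_eq.symm
  let e := LinearEquiv.ofBijective (B : V →ₗ[ℝ] V [⋀^Fin 1]→L[ℝ] ℝ)
    ⟨hB, (LinearMap.injective_iff_surjective_of_finrank_eq_finrank hrk).mp hB⟩
  exact ⟨e.toContinuousLinearEquiv, rfl⟩

variable {V' : Type*} [NormedAddCommGroup V'] [NormedSpace ℝ V']

theorem ContDiffAt.compContinuousLinearMap {n : WithTop ℕ∞} {f : W → V' [⋀^Fin k]→L[ℝ] ℝ}
    {g : W → V →L[ℝ] V'} {z : W} (hf : ContDiffAt ℝ n f z) (hg : ContDiffAt ℝ n g z) :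
    ContDiffAt ℝ n (fun y => (f y).compContinuousLinearMap (g y)) z :=
  contDiffAt_of_alternating_apply fun v => ContDiffAt.alternating_apply (v := fun y => g y ∘ v) hf
    (contDiffAt_pi.mpr fun _ => hg.clm_apply contDiffAt_const)

end ModelSpace


theorem minSmoothness_two_le_infty : minSmoothness ℝ 2 ≤ (∞ : WithTop ℕ∞) := by
  rw [minSmoothness_of_isRCLikeNormedField]
  exact WithTop.coe_le_coe.mpr (le_top : (2 : ℕ∞) ≤ ⊤)

section Charts

variable {E : Type*} [NormedAddCommGroup E] [NormedSpace ℝ E]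
  {H : Type*} [TopologicalSpace H] {I : ModelWithCorners ℝ E H} [I.Boundaryless]
  {M : Type*} [TopologicalSpace M] [ChartedSpace H M] [IsManifold I ∞ M] {k : ℕ}

theorem contMDiffAt_extChartAt_symm (x₀ : M) {z : E} (hz : z ∈ (extChartAt I x₀).target) :
    ContMDiffAt 𝓘(ℝ, E) I ∞ (extChartAt I x₀).symm z :=
  (contMDiffOn_extChartAt_symm x₀).contMDiffAt ((isOpen_extChartAt_target x₀).mem_nhds hz)

theorem mfderiv_extChartAt_comp_symm (x₀ : M) {z : E} (hz : z ∈ (extChartAt I x₀).target) (v : E) :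
    (mfderiv I 𝓘(ℝ, E) (extChartAt I x₀) ((extChartAt I x₀).symm z)
      (mfderiv 𝓘(ℝ, E) I (extChartAt I x₀).symm z v) : E) = v := by
  have : IsManifold I 1 M := IsManifold.of_le (n := ∞) (by simp)
  have h := mfderiv_extChartAt_comp_mfderivWithin_extChartAt_symm hz
  rw [I.range_eq_univ, mfderivWithin_univ] at h
  exact DFunLike.congr_fun h v

theorem mfderiv_extChartAt_symm_comp (x₀ : M) {z : E} (hz : z ∈ (extChartAt I x₀).target)
    (v : TangentSpace I ((extChartAt I x₀).symm z)) :
    mfderiv 𝓘(ℝ, E) I (extChartAt I x₀).symm z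
      (mfderiv I 𝓘(ℝ, E) (extChartAt I x₀) ((extChartAt I x₀).symm z) v) = v := by
  have : IsManifold I 1 M := IsManifold.of_le (n := ∞) (by simp)
  have h := mfderivWithin_extChartAt_symm_comp_mfderiv_extChartAt hz
  rw [I.range_eq_univ, mfderivWithin_univ] at h
  exact DFunLike.congr_fun h v

theorem mfderiv_extChartAt_self_apply (x : M) (v : TangentSpace I x) :
    (mfderiv I 𝓘(ℝ, E) (extChartAt I x) x v : E) = v := by
  have : IsManifold I 1 M := IsManifold.of_le (n := ∞) (by simp)
  rw [mfderiv_extChartAt_self]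
  rfl

theorem Form.apply_congr (η : Form I M k) {x y : M} (h : x = y) (v : Fin k → E) :
    (η x : E [⋀^Fin k]→L[ℝ] ℝ) v = (η y : E [⋀^Fin k]→L[ℝ] ℝ) v := by
  rw [h]

theorem Form.inChart_apply (η : Form I M k) (x₀ : M) (z : E) (v : Fin k → E) :
    η.inChart x₀ z v = (η ((extChartAt I x₀).symm z)) fun i =>
      mfderiv 𝓘(ℝ, E) I (extChartAt I x₀).symm z (v i) := rfl

theorem mfderiv_extChartAt_symm_self_apply (x : M) (v : E) :
    (mfderiv 𝓘(ℝ, E) I (extChartAt I x).symm (extChartAt I x x) v : E) = v := by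
  have h := mfderiv_extChartAt_comp_symm (I := I) x (mem_extChartAt_target x) v
  have h2 : ∀ y : M, y = x → ∀ w : E, (mfderiv I 𝓘(ℝ, E) (extChartAt I x) y w : E) = w := by
    rintro y rfl w
    exact mfderiv_extChartAt_self_apply y w
  exact (h2 _ (extChartAt_to_inv x) _).symm.trans h

theorem Form.inChart_self (η : Form I M k) (x : M) :
    η.inChart x (extChartAt I x x) = η x := by
  ext v
  rw [Form.inChart_apply]
  refine (η.apply_congr (extChartAt_to_inv x) _).trans ?_
  congr 1
  ext1 i
  exact mfderiv_extChartAt_symm_self_apply x (v i)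

theorem Form.d_eq (η : Form I M k) (x : M) :
    η.d x = extDeriv (η.inChart x) (extChartAt I x x) := by
  ext v
  change extDeriv (η.inChart x) (extChartAt I x x) _ = _
  congr 1
  ext1 i
  exact mfderiv_extChartAt_self_apply x (v i)

theorem smoothOn_univ_iff {η : Form I M k} :
    η.SmoothOn univ ↔ ∀ x₀, ∀ z ∈ (extChartAt I x₀).target, ContDiffAt ℝ ∞ (η.inChart x₀) z := by
  unfold Form.SmoothOn
  simp only [preimage_univ, inter_univ]
  exact forall_congr' fun x₀ => ⟨fun h z hz => h.contDiffAt
    ((isOpen_extChartAt_target x₀).mem_nhds hz), fun h z hz => (h z hz).contDiffWithinAt⟩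

variable {E' : Type*} [NormedAddCommGroup E'] [NormedSpace ℝ E']
  {H' : Type*} [TopologicalSpace H'] {I' : ModelWithCorners ℝ E' H'} [I'.Boundaryless]
  {M' : Type*} [TopologicalSpace M'] [ChartedSpace H' M'] [IsManifold I' ∞ M']

theorem contDiffAt_writtenInCharts {φ : M' → M} {x' : M'} {x₀ : M} {z : E'}
    (hz : z ∈ (extChartAt I' x').target) (hφ : ContMDiff I' I ∞ φ)
    (hx : φ ((extChartAt I' x').symm z) ∈ (extChartAt I x₀).source) :
    ContDiffAt ℝ ∞ (fun z => extChartAt I x₀ (φ ((extChartAt I' x').symm z))) z := by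
  have h1 := contMDiffAt_extChartAt_symm x' hz
  have h2 : ContMDiffAt I 𝓘(ℝ, E) ∞ (extChartAt I x₀) (φ ((extChartAt I' x').symm z)) :=
    contMDiffAt_extChartAt' (by rwa [extChartAt_source] at hx)
  exact (h2.comp z ((hφ _).comp z h1)).contDiffAt

theorem Form.inChart_pullback {φ : M' → M} (η : Form I M k) {x' : M'} {x₀ : M} {z : E'}
    (hz : z ∈ (extChartAt I' x').target) (hφ : ContMDiff I' I ∞ φ)
    (hx : φ ((extChartAt I' x').symm z) ∈ (extChartAt I x₀).source) :
    (η.pullback φ : Form I' M' k).inChart x' z =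
      (η.inChart x₀ (extChartAt I x₀ (φ ((extChartAt I' x').symm z)))).compContinuousLinearMap
        (fderiv ℝ (fun z => extChartAt I x₀ (φ ((extChartAt I' x').symm z))) z) := by
  have h1 := contMDiffAt_extChartAt_symm x' hz
  have hφ' : MDifferentiableAt I' I φ ((extChartAt I' x').symm z) := (hφ _).mdifferentiableAt (by simp)
  have hs : MDifferentiableAt 𝓘(ℝ, E') I' (extChartAt I' x').symm z := h1.mdifferentiableAt (by simp)
  set τ := fun z => extChartAt I x₀ (φ ((extChartAt I' x').symm z)) with hτ
  have hτd : MDifferentiableAt 𝓘(ℝ, E') 𝓘(ℝ, E) τ z :=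
    ((contDiffAt_writtenInCharts hz hφ hx).differentiableAt (by simp)).mdifferentiableAt
  have hτz : τ z ∈ (extChartAt I x₀).target := (extChartAt I x₀).map_source hx
  have hs' : MDifferentiableAt 𝓘(ℝ, E) I (extChartAt I x₀).symm (τ z) :=
    (contMDiffAt_extChartAt_symm x₀ hτz).mdifferentiableAt (by simp)
  have hev : ((extChartAt I x₀).symm ∘ τ) =ᶠ[𝓝 z] (φ ∘ (extChartAt I' x').symm) := by
    have hc : ContinuousAt (fun z => φ ((extChartAt I' x').symm z)) z :=
      hφ.continuous.continuousAt.comp h1.continuousAt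
    filter_upwards [hc.preimage_mem_nhds ((isOpen_extChartAt_source x₀).mem_nhds hx)] with y hy
    exact (extChartAt I x₀).left_inv hy
  have hd : ∀ v : E', (mfderiv 𝓘(ℝ, E) I (extChartAt I x₀).symm (τ z) (fderiv ℝ τ z v) : E) =
      (mfderiv I' I φ ((extChartAt I' x').symm z)
        (mfderiv 𝓘(ℝ, E') I' (extChartAt I' x').symm z v) : E) := by
    intro v
    have e1 := mfderiv_comp z hs' hτd
    have e2 := mfderiv_comp z hφ' hs
    have e3 : (mfderiv 𝓘(ℝ, E') I ((extChartAt I x₀).symm ∘ τ) z : E' →L[ℝ] E) =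
      (mfderiv 𝓘(ℝ, E') I (φ ∘ (extChartAt I' x').symm) z : E' →L[ℝ] E) := hev.mfderiv_eq
    rw [mfderiv_eq_fderiv] at e1
    have e4 := DFunLike.congr_fun (e1.symm.trans (e3.trans e2)) v
    exact e4
  ext v
  change (η (φ ((extChartAt I' x').symm z)) : E [⋀^Fin k]→L[ℝ] ℝ) _ =
    (η ((extChartAt I x₀).symm (τ z)) : E [⋀^Fin k]→L[ℝ] ℝ) _
  refine Eq.trans ?_ (η.apply_congr ((extChartAt I x₀).left_inv hx).symm _)
  congr 1
  ext1 i
  exact (hd (v i)).symm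

theorem Form.inChart_pullback_eventuallyEq {φ : M' → M} (η : Form I M k) {x' : M'} {x₀ : M} {z : E'}
    (hz : z ∈ (extChartAt I' x').target) (hφ : ContMDiff I' I ∞ φ)
    (hx : φ ((extChartAt I' x').symm z) ∈ (extChartAt I x₀).source) :
    (η.pullback φ : Form I' M' k).inChart x' =ᶠ[𝓝 z] fun z =>
      (η.inChart x₀ (extChartAt I x₀ (φ ((extChartAt I' x').symm z)))).compContinuousLinearMap
        (fderiv ℝ (fun z => extChartAt I x₀ (φ ((extChartAt I' x').symm z))) z) := by
  have hc : ContinuousAt (fun z => φ ((extChartAt I' x').symm z)) z :=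
    hφ.continuous.continuousAt.comp (contMDiffAt_extChartAt_symm x' hz).continuousAt
  filter_upwards [hc.preimage_mem_nhds ((isOpen_extChartAt_source x₀).mem_nhds hx),
    (isOpen_extChartAt_target x').mem_nhds hz] with y hy hy'
  exact η.inChart_pullback hy' hφ hy

theorem extDeriv_inChart_pullback {φ : M' → M} {η : Form I M k} (hη : η.SmoothOn univ)
    {x' : M'} {x₀ : M} {z : E'} (hz : z ∈ (extChartAt I' x').target) (hφ : ContMDiff I' I ∞ φ)
    (hx : φ ((extChartAt I' x').symm z) ∈ (extChartAt I x₀).source) :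
    extDeriv ((η.pullback φ : Form I' M' k).inChart x') z =
      (extDeriv (η.inChart x₀)
        (extChartAt I x₀ (φ ((extChartAt I' x').symm z)))).compContinuousLinearMap
        (fderiv ℝ (fun z => extChartAt I x₀ (φ ((extChartAt I' x').symm z))) z) := by
  rw [(η.inChart_pullback_eventuallyEq hz hφ hx).extDeriv_eq]
  exact extDeriv_pullback (f := fun z => extChartAt I x₀ (φ ((extChartAt I' x').symm z)))
    ((smoothOn_univ_iff.mp hη x₀ _ ((extChartAt I x₀).map_source hx)).differentiableAt (by simp))
    (contDiffAt_writtenInCharts hz hφ hx) minSmoothness_two_le_infty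

theorem Form.pullback_id (η : Form I M k) : (η.pullback id : Form I M k) = η := by
  funext x
  ext v
  change η x _ = η x _
  congr 1
  ext1 i
  change mfderiv I I id x (v i) = v i
  rw [mfderiv_id]
  rfl

/-- The exterior derivative is independent of the chart. -/
theorem Form.inChart_d {η : Form I M k} (hη : η.SmoothOn univ) {x₀ : M} {z : E}
    (hz : z ∈ (extChartAt I x₀).target) : η.d.inChart x₀ z = extDeriv (η.inChart x₀) z := by
  have h1 := extDeriv_inChart_pullback (φ := id) hη hz contMDiff_id
    (mem_extChartAt_source (I := I) ((extChartAt I x₀).symm z))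
  have h2 := η.d.inChart_pullback (φ := id) hz contMDiff_id
    (mem_extChartAt_source (I := I) ((extChartAt I x₀).symm z))
  rw [Form.pullback_id] at h1 h2
  rw [h1, h2]
  congr 1
  exact (Form.inChart_self _ _).trans (Form.d_eq _ _)

theorem Form.d_pullback {φ : M' → M} {η : Form I M k} (hη : η.SmoothOn univ)
    (hφ : ContMDiff I' I ∞ φ) : (η.pullback φ : Form I' M' k).d = η.d.pullback φ := by
  funext x'
  have hz := mem_extChartAt_target (I := I') x'
  have h0 : φ ((extChartAt I' x').symm (extChartAt I' x' x')) ∈ (extChartAt I (φ x')).source := by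
    rw [extChartAt_to_inv]
    exact mem_extChartAt_source _
  have h1 := extDeriv_inChart_pullback (φ := φ) hη hz hφ h0
  have h2 := η.d.inChart_pullback (φ := φ) hz hφ h0
  rw [Form.d_eq, h1, ← Form.inChart_self (η.d.pullback φ) x', h2, Form.inChart_d hη]
  exact (extChartAt I (φ x')).map_source h0

end Charts


section Calculus

variable {E : Type*} [NormedAddCommGroup E] [NormedSpace ℝ E] [FiniteDimensional ℝ E]
  {H : Type*} [TopologicalSpace H] {I : ModelWithCorners ℝ E H} [I.Boundaryless]
  {M : Type*} [TopologicalSpace M] [ChartedSpace H M] [IsManifold I ∞ M] {k : ℕ}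

theorem contMDiffAt_iff_comp_extChartAt_symm {F : Type*} [NormedAddCommGroup F] [NormedSpace ℝ F]
    {f : M → F} {x₀ : M} {z : E} (hz : z ∈ (extChartAt I x₀).target) :
    ContMDiffAt I 𝓘(ℝ, F) ∞ f ((extChartAt I x₀).symm z) ↔
      ContDiffAt ℝ ∞ (fun y => f ((extChartAt I x₀).symm y)) z := by
  have hs : (extChartAt I x₀).symm z ∈ (extChartAt I x₀).source := (extChartAt I x₀).map_target hz
  constructor
  · intro h
    exact (h.comp z (contMDiffAt_extChartAt_symm x₀ hz)).contDiffAt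
  · intro h
    have h1 : ContMDiffAt I 𝓘(ℝ, E) ∞ (extChartAt I x₀) ((extChartAt I x₀).symm z) :=
      contMDiffAt_extChartAt' (by rwa [extChartAt_source] at hs)
    have h2 : ContMDiffAt 𝓘(ℝ, E) 𝓘(ℝ, F) ∞ (fun y => f ((extChartAt I x₀).symm y))
        (extChartAt I x₀ ((extChartAt I x₀).symm z)) := by
      rw [(extChartAt I x₀).right_inv hz]
      exact h.contMDiffAt
    refine (h2.comp _ h1).congr_of_eventuallyEq ?_
    filter_upwards [(isOpen_extChartAt_source x₀).mem_nhds hs] with y hy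
    exact congrArg f ((extChartAt I x₀).left_inv hy).symm

theorem smoothVFOn_iff {X : (x : M) → TangentSpace I x} {U : Set M} (hU : IsOpen U) :
    SmoothVFOn X U ↔ ∀ x₀, ∀ z ∈ (extChartAt I x₀).target, (extChartAt I x₀).symm z ∈ U →
      ContDiffAt ℝ ∞ (vfInChart X x₀) z := by
  have : IsManifold I 1 M := IsManifold.of_le (n := ∞) (by simp)
  have key : ∀ x₀, ∀ z ∈ (extChartAt I x₀).target,
      ContMDiffAt I I.tangent ∞ (fun x => (⟨x, X x⟩ : TangentBundle I M))
        ((extChartAt I x₀).symm z) ↔ ContDiffAt ℝ ∞ (vfInChart X x₀) z := by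
    intro x₀ z hz
    have hs : (extChartAt I x₀).symm z ∈ (chartAt H x₀).source := by
      rw [← extChartAt_source I]
      exact (extChartAt I x₀).map_target hz
    refine (Trivialization.contMDiffAt_section_iff (IB := I) (n := ∞)
      (e := trivializationAt E (TangentSpace I) x₀) (s := X) hs).trans ?_
    refine Iff.trans ?_ (contMDiffAt_iff_comp_extChartAt_symm (F := E)
      (f := fun x => (mfderiv I 𝓘(ℝ, E) (extChartAt I x₀) x (X x) : E)) hz)
    refine Filter.EventuallyEq.contMDiffAt_iff ?_
    filter_upwards [(chartAt H x₀).open_source.mem_nhds hs] with y hy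
    have h := TangentBundle.continuousLinearMapAt_trivializationAt (I := I) hy
    exact ((trivializationAt E (TangentSpace I) x₀).continuousLinearMapAt_apply_of_mem ℝ hy
      (X y)).symm.trans (DFunLike.congr_fun h (X y))
  constructor
  · intro h x₀ z hz hzU
    exact (key x₀ z hz).mp ((h _ hzU).contMDiffAt (hU.mem_nhds hzU))
  · intro h x hx
    have h1 := (key x _ (mem_extChartAt_target x)).mpr
      (h x _ (mem_extChartAt_target x) (by rwa [extChartAt_to_inv]))
    rw [extChartAt_to_inv] at h1
    exact h1.contMDiffWithinAt

theorem contMDiff_iff_comp_extChartAt_symm {F : Type*} [NormedAddCommGroup F] [NormedSpace ℝ F]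
    {f : M → F} : ContMDiff I 𝓘(ℝ, F) ∞ f ↔ ∀ x₀, ∀ z ∈ (extChartAt I x₀).target,
      ContDiffAt ℝ ∞ (fun y => f ((extChartAt I x₀).symm y)) z := by
  constructor
  · intro h x₀ z hz
    exact (contMDiffAt_iff_comp_extChartAt_symm hz).mp (h _)
  · intro h x
    have h1 := (contMDiffAt_iff_comp_extChartAt_symm (mem_extChartAt_target x)).mpr
      (h x _ (mem_extChartAt_target x))
    rwa [extChartAt_to_inv] at h1

theorem vfInChart_self (X : (x : M) → TangentSpace I x) (x : M) :
    vfInChart X x (extChartAt I x x) = X x := by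
  have h : ∀ y : M, y = x → (mfderiv I 𝓘(ℝ, E) (extChartAt I x) y (X y) : E) = X x := by
    rintro y rfl
    exact mfderiv_extChartAt_self_apply y _
  exact h _ (extChartAt_to_inv x)

namespace Form

/-- The product of a function and a form. -/
def fsmul (c : M → ℝ) (η : Form I M k) : Form I M k := fun x => c x • η x

theorem inChart_add (η η' : Form I M k) (x₀ : M) :
    (η + η').inChart x₀ = η.inChart x₀ + η'.inChart x₀ := rfl

theorem inChart_wedge (β : Form I M 1) (η : Form I M k) (x₀ : M) (z : E) :
    (β.wedge η).inChart x₀ z = LCS.wedge (β.inChart x₀ z) (η.inChart x₀ z) := by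
  exact wedge_compContinuousLinearMap (V := E) (W := E) (β _) (η _) _

theorem inChart_interior (X : (x : M) → TangentSpace I x) (η : Form I M (k + 1)) (x₀ : M) {z : E}
    (hz : z ∈ (extChartAt I x₀).target) :
    (η.interior X).inChart x₀ z = (η.inChart x₀ z).curryLeft (vfInChart X x₀ z) := by
  ext v
  change η _ _ = η _ _
  congr 1
  ext1 i
  refine Fin.cases ?_ (fun j => ?_) i
  · exact (mfderiv_extChartAt_symm_comp x₀ hz _).symm
  · rfl

variable {η η' : Form I M k} {β : Form I M 1}

theorem SmoothOn.contDiffAt (hη : η.SmoothOn univ) {x₀ : M} {z : E}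
    (hz : z ∈ (extChartAt I x₀).target) : ContDiffAt ℝ ∞ (η.inChart x₀) z :=
  smoothOn_univ_iff.mp hη x₀ z hz

theorem SmoothOn.differentiableAt (hη : η.SmoothOn univ) {x₀ : M} {z : E}
    (hz : z ∈ (extChartAt I x₀).target) : DifferentiableAt ℝ (η.inChart x₀) z :=
  (hη.contDiffAt hz).differentiableAt (by simp)

theorem SmoothOn.add (hη : η.SmoothOn univ) (hη' : η'.SmoothOn univ) :
    (η + η').SmoothOn univ :=
  smoothOn_univ_iff.mpr fun _ _ hz => (hη.contDiffAt hz).add (hη'.contDiffAt hz)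

theorem SmoothOn.sub (hη : η.SmoothOn univ) (hη' : η'.SmoothOn univ) :
    (η - η').SmoothOn univ :=
  smoothOn_univ_iff.mpr fun _ _ hz => (hη.contDiffAt hz).sub (hη'.contDiffAt hz)

theorem SmoothOn.wedge (hβ : β.SmoothOn univ) (hη : η.SmoothOn univ) :
    (β.wedge η).SmoothOn univ :=
  smoothOn_univ_iff.mpr fun x₀ z hz => by
    have h : (β.wedge η).inChart x₀ = fun z => wedgeL E k (β.inChart x₀ z) (η.inChart x₀ z) :=
      funext fun z => inChart_wedge β η x₀ z
    rw [h]
    exact (((wedgeL E k).contDiff.contDiffAt.comp z (hβ.contDiffAt hz)).clm_apply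
      (hη.contDiffAt hz))

theorem SmoothOn.d (hη : η.SmoothOn univ) : η.d.SmoothOn univ :=
  smoothOn_univ_iff.mpr fun x₀ z hz => by
    have h : η.d.inChart x₀ =ᶠ[𝓝 z] extDeriv (η.inChart x₀) := by
      filter_upwards [(isOpen_extChartAt_target x₀).mem_nhds hz] with y hy
      exact inChart_d hη hy
    refine ContDiffAt.congr_of_eventuallyEq ?_ h
    have h1 : ContDiffAt ℝ ∞ (fderiv ℝ (η.inChart x₀)) z :=
      (hη.contDiffAt hz).fderiv_right (by simp)
    exact (ContinuousAlternatingMap.alternatizeUncurryFinCLM ℝ E ℝ).contDiff.contDiffAt.comp z h1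

theorem SmoothOn.twistedD (hβ : β.SmoothOn univ) (hη : η.SmoothOn univ) :
    (Form.twistedD β η).SmoothOn univ :=
  hη.d.add (hβ.wedge hη)

theorem SmoothOn.smul {c : M → ℝ} (hc : ContMDiff I 𝓘(ℝ, ℝ) ∞ c) (hη : η.SmoothOn univ) :
    (fsmul c η).SmoothOn univ :=
  smoothOn_univ_iff.mpr fun x₀ _ hz =>
    (contMDiff_iff_comp_extChartAt_symm.mp hc x₀ _ hz).smul (hη.contDiffAt hz)

theorem smoothOn_ofFun {f : M → ℝ} (hf : ContMDiff I 𝓘(ℝ, ℝ) ∞ f) :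
    (Form.ofFun f : Form I M 0).SmoothOn univ :=
  smoothOn_univ_iff.mpr fun x₀ _ hz => contDiffAt_of_alternating_apply fun _ =>
    contMDiff_iff_comp_extChartAt_symm.mp hf x₀ _ hz

theorem SmoothOn.interior {η : Form I M (k + 1)} (hη : η.SmoothOn univ)
    {X : (x : M) → TangentSpace I x} (hX : SmoothVFOn X univ) : (η.interior X).SmoothOn univ :=
  smoothOn_univ_iff.mpr fun x₀ z hz => contDiffAt_of_alternating_apply fun v => by
    have hX' := (smoothVFOn_iff isOpen_univ).mp hX x₀ z hz (mem_univ _)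
    have h : ContDiffAt ℝ ∞ (fun y => η.inChart x₀ y (Matrix.vecCons (vfInChart X x₀ y) v)) z := by
      refine ContDiffAt.alternating_apply (hη.contDiffAt hz) (contDiffAt_pi.mpr fun i => ?_)
      refine Fin.cases ?_ (fun j => ?_) i
      · exact hX'
      · exact contDiffAt_const
    refine h.congr_of_eventuallyEq ?_
    filter_upwards [(isOpen_extChartAt_target x₀).mem_nhds hz] with y hy
    rw [inChart_interior X η x₀ hy]
    rfl

theorem d_add (hη : η.SmoothOn univ) (hη' : η'.SmoothOn univ) : (η + η').d = η.d + η'.d := by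
  funext x
  have hz := mem_extChartAt_target (I := I) x
  rw [d_eq, inChart_add, extDeriv_add (hη.differentiableAt hz) (hη'.differentiableAt hz)]
  change _ = η.d x + η'.d x
  rw [d_eq, d_eq]
  rfl

theorem d_sub (hη : η.SmoothOn univ) (hη' : η'.SmoothOn univ) : (η - η').d = η.d - η'.d := by
  have h := d_add (hη.sub hη') hη'
  rw [sub_add_cancel] at h
  rw [h, add_sub_cancel_right]

theorem d_d (hη : η.SmoothOn univ) : η.d.d = 0 := by
  funext x
  have hz := mem_extChartAt_target (I := I) x
  have h : η.d.inChart x =ᶠ[𝓝 (extChartAt I x x)] extDeriv (η.inChart x) := by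
    filter_upwards [(isOpen_extChartAt_target x).mem_nhds hz] with y hy
    exact inChart_d hη hy
  rw [d_eq, h.extDeriv_eq, extDeriv_extDeriv_apply (hη.contDiffAt hz) minSmoothness_two_le_infty]
  rfl

theorem d_wedge (hβ : β.SmoothOn univ) (hη : η.SmoothOn univ) (hd : β.d = 0) :
    (β.wedge η).d = -β.wedge η.d := by
  funext x
  have hz := mem_extChartAt_target (I := I) x
  have h : (β.wedge η).inChart x = fun z => LCS.wedge (β.inChart x z) (η.inChart x z) :=
    funext fun z => inChart_wedge β η x z
  have h0 : extDeriv (β.inChart x) (extChartAt I x x) = 0 := by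
    rw [← d_eq, hd]
    rfl
  rw [d_eq, h, extDeriv_wedge_of_closed (hβ.differentiableAt hz) (hη.differentiableAt hz) h0,
    ← d_eq, inChart_self]
  rfl

theorem wedge_add (β : Form I M 1) (η η' : Form I M k) :
    β.wedge (η + η') = β.wedge η + β.wedge η' :=
  funext fun x => (wedgeL E k (β x)).map_add (η x) (η' x)

theorem wedge_sub (β : Form I M 1) (η η' : Form I M k) :
    β.wedge (η - η') = β.wedge η - β.wedge η' :=
  funext fun x => (wedgeL E k (β x)).map_sub (η x) (η' x)

theorem twistedD_add (β : Form I M 1) (hη : η.SmoothOn univ) (hη' : η'.SmoothOn univ) :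
    twistedD β (η + η') = twistedD β η + twistedD β η' := by
  unfold twistedD
  rw [d_add hη hη', wedge_add]
  abel

theorem twistedD_sub (β : Form I M 1) (hη : η.SmoothOn univ) (hη' : η'.SmoothOn univ) :
    twistedD β (η - η') = twistedD β η - twistedD β η' := by
  unfold twistedD
  rw [d_sub hη hη', wedge_sub]
  abel

theorem twistedD_twistedD (hβ : β.SmoothOn univ) (hη : η.SmoothOn univ) (hd : β.d = 0) :
    twistedD β (twistedD β η) = 0 := by
  have h : β.wedge (β.wedge η) = 0 :=
    funext fun x => wedge_wedge_self (V := E) (β x) (η x)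
  unfold twistedD
  rw [d_add hη.d (hβ.wedge hη), d_d hη, d_wedge hβ hη hd, wedge_add, h]
  abel

theorem d_smul {c : M → ℝ} (hc : ContMDiff I 𝓘(ℝ, ℝ) ∞ c) (hη : η.SmoothOn univ)
    (hd : (Form.ofFun c : Form I M 0).d = 0) :
    (fsmul c η).d = fsmul c η.d := by
  funext x
  have hz := mem_extChartAt_target (I := I) x
  have hc' := contMDiff_iff_comp_extChartAt_symm.mp hc x _ hz
  have h0 : fderiv ℝ (fun y => c ((extChartAt I x).symm y)) (extChartAt I x x) = 0 := by
    have h1 : (Form.ofFun c : Form I M 0).d x = 0 := by rw [hd]; rfl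
    rw [d_eq] at h1
    have h2 := (extDeriv_constOfIsEmpty (fun y => c ((extChartAt I x).symm y))
      (extChartAt I x x)).symm.trans h1
    exact (ContinuousAlternatingMap.ofSubsingleton ℝ E ℝ (0 : Fin 1)).injective h2
  unfold fsmul
  rw [d_eq, d_eq]
  refine (extDeriv_smul_of_fderiv_eq_zero (hc'.differentiableAt (by simp)) (hη.differentiableAt hz)
    h0).trans ?_
  rw [extChartAt_to_inv]
  rfl

theorem twistedD_smul {c : M → ℝ} (hc : ContMDiff I 𝓘(ℝ, ℝ) ∞ c) (hη : η.SmoothOn univ)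
    (hd : (Form.ofFun c : Form I M 0).d = 0) :
    twistedD β (fsmul c η) = fsmul c (twistedD β η) := by
  unfold twistedD
  rw [d_smul hc hη hd]
  funext x
  exact (congrArg (c x • η.d x + ·) ((wedgeL E k (β x)).map_smul (c x) (η x))).trans
    (smul_add (c x) (η.d x) (β.wedge η x)).symm

theorem lieDeriv_eq {η : Form I M (k + 1)} {X : (x : M) → TangentSpace I x} {x : M}
    (hη : DifferentiableAt ℝ (η.inChart x) (extChartAt I x x))
    (hX : DifferentiableAt ℝ (vfInChart X x) (extChartAt I x x))
    (v : Fin (k + 1) → TangentSpace I x) :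
    η.lieDeriv X x v = η.d.interior X x v + (η.interior X).d x v := by
  have hw : (fun i => (mfderiv I 𝓘(ℝ, E) (extChartAt I x) x (v i) : E)) = v :=
    funext fun i => mfderiv_extChartAt_self_apply x (v i)
  have hc := fderiv_apply_add_sum_update hη hX
    fun i => (mfderiv I 𝓘(ℝ, E) (extChartAt I x) x (v i) : E)
  have hi : (η.interior X).inChart x =ᶠ[𝓝 (extChartAt I x x)]
      fun y => (η.inChart x y).curryLeft (vfInChart X x y) := by
    filter_upwards [(isOpen_extChartAt_target x).mem_nhds (mem_extChartAt_target (I := I) x)]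
      with y hy
    exact inChart_interior X η x hy
  rw [d_eq, hi.extDeriv_eq]
  unfold lieDeriv
  refine hc.trans ?_
  rw [hw, vfInChart_self, ← d_eq]
  rfl

theorem d_congr {η η' : Form I M k} {U : Set M} (hU : IsOpen U) (h : ∀ x ∈ U, η x = η' x) {x : M}
    (hx : x ∈ U) : η.d x = η'.d x := by
  rw [d_eq, d_eq]
  refine Filter.EventuallyEq.extDeriv_eq ?_
  have hc := (contMDiffAt_extChartAt_symm (I := I) x (mem_extChartAt_target x)).continuousAt
  filter_upwards [hc.preimage_mem_nhds (hU.mem_nhds (by rwa [extChartAt_to_inv]))] with y hy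
  ext v
  rw [inChart_apply, inChart_apply, h _ hy]

theorem lieDeriv_eq_twistedD {η : Form I M (k + 1)} {X : (x : M) → TangentSpace I x} {x : M}
    (hη : DifferentiableAt ℝ (η.inChart x) (extChartAt I x x))
    (hX : DifferentiableAt ℝ (vfInChart X x) (extChartAt I x x))
    (hd : twistedD β η x = 0) (v : Fin (k + 1) → TangentSpace I x) :
    η.lieDeriv X x v = twistedD β (η.interior X) x v - β x ![X x] * η x v := by
  have h1 : η.d x = -β.wedge η x := eq_neg_of_add_eq_zero_left hd
  have h2 : η.d.interior X x = (β.wedge (η.interior X)) x - β x ![X x] • η x := by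
    have h3 := curryLeft_wedge (V := E) (β x) (η x) (X x)
    change ContinuousAlternatingMap.curryLeft (E := E) (η.d x) (X x) = _
    rw [h1]
    refine Eq.trans ?_ ((congrArg (fun t => -t) h3).trans (neg_sub _ _))
    rfl
  rw [lieDeriv_eq hη hX, h2]
  have h3 : ∀ a b c : ℝ, a - b + c = c + a - b := fun a b c => by ring
  exact h3 _ _ _

/-- The function `β(X)`. -/
def contract (β : Form I M 1) (X : (x : M) → TangentSpace I x) (x : M) : ℝ := β x ![X x]

theorem contract_extChartAt_symm (β : Form I M 1) (X : (x : M) → TangentSpace I x) (x₀ : M) {z : E}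
    (hz : z ∈ (extChartAt I x₀).target) :
    β.contract X ((extChartAt I x₀).symm z) = β.inChart x₀ z ![vfInChart X x₀ z] := by
  change β _ _ = β _ _
  congr 1
  ext i
  fin_cases i
  exact (mfderiv_extChartAt_symm_comp x₀ hz _).symm

theorem contMDiffAt_contract (hβ : β.SmoothOn univ) {X : (x : M) → TangentSpace I x} {U : Set M}
    (hU : IsOpen U) (hX : SmoothVFOn X U) {x : M} (hx : x ∈ U) :
    ContMDiffAt I 𝓘(ℝ, ℝ) ∞ (β.contract X) x := by
  have hz := mem_extChartAt_target (I := I) x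
  have h := contMDiffAt_iff_comp_extChartAt_symm (f := β.contract X) hz
  rw [extChartAt_to_inv] at h
  refine h.mpr ?_
  have hX' := (smoothVFOn_iff hU).mp hX x _ hz (by rwa [extChartAt_to_inv])
  have h1 : ContDiffAt ℝ ∞ (fun y => β.inChart x y ![vfInChart X x y]) (extChartAt I x x) :=
    ContDiffAt.alternating_apply (hβ.contDiffAt hz) (contDiffAt_pi.mpr fun i => by
      fin_cases i
      exact hX')
  refine h1.congr_of_eventuallyEq ?_
  filter_upwards [(isOpen_extChartAt_target x).mem_nhds hz] with y hy
  exact contract_extChartAt_symm β X x hy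

theorem interior_eq_ofFun (β : Form I M 1) (X : (x : M) → TangentSpace I x) :
    β.interior X = Form.ofFun (β.contract X) := by
  funext x
  ext v
  change β x _ = β x _
  congr 1
  ext i
  fin_cases i
  rfl

theorem lieDeriv_closed {X : (x : M) → TangentSpace I x} {x : M}
    (hβ : DifferentiableAt ℝ (β.inChart x) (extChartAt I x x))
    (hX : DifferentiableAt ℝ (vfInChart X x) (extChartAt I x x))
    (hd : β.d = 0) (v : Fin 1 → TangentSpace I x) :
    β.lieDeriv X x v = (Form.ofFun (β.contract X) : Form I M 0).d x v := by
  rw [lieDeriv_eq hβ hX, interior_eq_ofFun, hd]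
  exact zero_add _

theorem d_ofFun_sub {f g : M → ℝ} {x : M} (hf : ContMDiffAt I 𝓘(ℝ, ℝ) ∞ f x)
    (hg : ContMDiffAt I 𝓘(ℝ, ℝ) ∞ g x) :
    (Form.ofFun (fun x => f x - g x) : Form I M 0).d x =
      (Form.ofFun f : Form I M 0).d x - (Form.ofFun g : Form I M 0).d x := by
  have key : ∀ {f : M → ℝ}, ContMDiffAt I 𝓘(ℝ, ℝ) ∞ f x →
      DifferentiableAt ℝ ((Form.ofFun f : Form I M 0).inChart x) (extChartAt I x x) := by
    intro f hf
    rw [← extChartAt_to_inv (I := I) x] at hf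
    have h := (contMDiffAt_iff_comp_extChartAt_symm (mem_extChartAt_target x)).mp hf
    refine ContDiffAt.differentiableAt (n := ∞) (contDiffAt_of_alternating_apply fun _ => h) ?_
    simp
  have h := extDeriv_add (key (hf.sub hg)) (key hg)
  rw [← d_eq, ← d_eq] at h
  rw [eq_sub_iff_add_eq]
  refine h.symm.trans ?_
  rw [d_eq]
  congr 1
  funext z
  ext v
  exact sub_add_cancel _ _

variable {E' : Type*} [NormedAddCommGroup E'] [NormedSpace ℝ E'] [FiniteDimensional ℝ E']
  {H' : Type*} [TopologicalSpace H'] {I' : ModelWithCorners ℝ E' H'} [I'.Boundaryless]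
  {M' : Type*} [TopologicalSpace M'] [ChartedSpace H' M'] [IsManifold I' ∞ M']

theorem SmoothOn.pullback {φ : M' → M} (hη : η.SmoothOn univ) (hφ : ContMDiff I' I ∞ φ) :
    (η.pullback φ : Form I' M' k).SmoothOn univ :=
  smoothOn_univ_iff.mpr fun x' z hz => by
    have hx := mem_extChartAt_source (I := I) (φ ((extChartAt I' x').symm z))
    refine ContDiffAt.congr_of_eventuallyEq ?_ (η.inChart_pullback_eventuallyEq hz hφ hx)
    have h := contDiffAt_writtenInCharts hz hφ hx
    refine ContDiffAt.compContinuousLinearMap ?_ (h.fderiv_right (by simp))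
    exact (hη.contDiffAt ((extChartAt I _).map_source hx)).comp z h

theorem pullback_wedge (φ : M' → M) (β : Form I M 1) (η : Form I M k) :
    ((β.wedge η).pullback φ : Form I' M' (k + 1)) = (β.pullback φ).wedge (η.pullback φ) := by
  funext x
  exact wedge_compContinuousLinearMap (V := E') (W := E) (β _) (η _) _

theorem pullback_twistedD {φ : M' → M} (hη : η.SmoothOn univ) (hφ : ContMDiff I' I ∞ φ) :
    ((twistedD β η).pullback φ : Form I' M' (k + 1)) = twistedD (β.pullback φ) (η.pullback φ) := by
  unfold twistedD
  rw [d_pullback hη hφ, ← pullback_wedge]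
  rfl

end Form

end Calculus


section DualBundle

variable {E : Type*} [NormedAddCommGroup E] [NormedSpace ℝ E] [FiniteDimensional ℝ E]
  {H : Type*} [TopologicalSpace H] {I : ModelWithCorners ℝ E H} [I.Boundaryless]
  {M : Type*} [TopologicalSpace M] [ChartedSpace H M] [IsManifold I ∞ M]

namespace LCPS

variable {S : LCPS I M}

theorem contMDiff_dualProj : ContMDiff S.dualModel I ∞ S.dualProj :=
  Bundle.contMDiff_proj _

theorem contMDiff_zeroSec : ContMDiff I S.dualModel ∞ S.zeroSec :=
  Bundle.contMDiff_zeroSection ℝ _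

theorem mem_locBase_of_mem_target {α₀ : S.CharDual} {z : E × S.DualFibre}
    (hz : z ∈ (extChartAt S.dualModel α₀).target) :
    z.1 ∈ (extChartAt I α₀.1).target ∧ (extChartAt I α₀.1).symm z.1 ∈ S.locBase α₀.1 := by
  rw [FiberBundle.extChartAt_target] at hz
  exact ⟨hz.1.1, hz.1.2.1⟩

theorem dualProj_extChartAt_symm (α₀ : S.CharDual) (z : E × S.DualFibre)
    (hz : z ∈ (extChartAt S.dualModel α₀).target) :
    S.dualProj ((extChartAt S.dualModel α₀).symm z) = (extChartAt I α₀.1).symm z.1 := by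
  rw [FiberBundle.extChartAt]
  refine (trivializationAt S.DualFibre (fun x : M => S.Char x →L[ℝ] Trivial M ℝ x) α₀.1).proj_symm_apply' ?_
  exact ⟨(mem_locBase_of_mem_target hz).2, mem_univ _⟩

theorem dual_apply_eq (α₀ α : S.CharDual) (h : α.1 ∈ S.locBase α₀.1) (v : S.Char α.1) :
    α.2 v = (extChartAt S.dualModel α₀ α).2 (S.locP α₀.1
      ((trivializationAt E (TangentSpace I) α₀.1).continuousLinearMapAt ℝ α.1 (S.incl α.1 v))) := by
  have hb : α.1 ∈ (trivializationAt (EuclideanSpace ℝ (Fin S.corank)) S.Char α₀.1).baseSet := h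
  have h1 : ∀ k, (extChartAt S.dualModel α₀ α).2 k =
      α.2 ((trivializationAt (EuclideanSpace ℝ (Fin S.corank)) S.Char α₀.1).symmL ℝ α.1 k) := by
    intro k
    rw [FiberBundle.extChartAt]
    change ((trivializationAt ℝ (Trivial M ℝ) α₀.1).continuousLinearMapAt ℝ α.1) _ = _
    rw [(trivializationAt ℝ (Trivial M ℝ) α₀.1).continuousLinearMapAt_apply_of_mem ℝ (by exact mem_univ _)]
    rfl
  rw [h1]
  congr 1
  have h2 := (trivializationAt (EuclideanSpace ℝ (Fin S.corank)) S.Char α₀.1).symmL_continuousLinearMapAt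
    (R := ℝ) hb v
  rw [(trivializationAt (EuclideanSpace ℝ (Fin S.corank)) S.Char
    α₀.1).continuousLinearMapAt_apply_of_mem ℝ hb] at h2
  exact h2.symm

/-- The projection to the characteristic distribution along `G`, as an endomorphism of the tangent
space. -/
def Splitting.projEnd (P : S.Splitting) (x : M) : TangentSpace I x →L[ℝ] TangentSpace I x :=
  LinearMap.toContinuousLinearMap ((S.form.nullSpace x).projection (P.G x) (P.isCompl x))

theorem Splitting.incl_proj (P : S.Splitting) (x : M) (v : TangentSpace I x) :
    S.incl x (P.proj x v) = P.projEnd x v := rfl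

/-- The coordinate expression of `p_G`, in the preferred chart at `x₀`. -/
def Splitting.projInChart (P : S.Splitting) (x₀ : M) (y : E) :
    E →L[ℝ] EuclideanSpace ℝ (Fin S.corank) :=
  S.locP x₀ ∘L ((trivializationAt E (TangentSpace I) x₀).continuousLinearMapAt ℝ
      ((extChartAt I x₀).symm y) ∘L P.projEnd ((extChartAt I x₀).symm y) ∘L
    (trivializationAt E (TangentSpace I) x₀).symmL ℝ ((extChartAt I x₀).symm y))

theorem symmL_eq_mfderiv {x₀ : M} {y : E} (hy : y ∈ (extChartAt I x₀).target) (v : E) :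
    (trivializationAt E (TangentSpace I) x₀).symmL ℝ ((extChartAt I x₀).symm y) v =
      mfderiv 𝓘(ℝ, E) I (extChartAt I x₀).symm y v := by
  have : IsManifold I 1 M := IsManifold.of_le (n := ∞) (by simp)
  have hs : (extChartAt I x₀).symm y ∈ (chartAt H x₀).source := by
    rw [← extChartAt_source I]
    exact (extChartAt I x₀).map_target hy
  have h := TangentBundle.symmL_trivializationAt (I := I) hs
  rw [I.range_eq_univ, mfderivWithin_univ, (extChartAt I x₀).right_inv hy] at h
  exact DFunLike.congr_fun h v

theorem Splitting.contDiffAt_projInChart (P : S.Splitting) {x₀ : M} {y : E}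
    (hy : y ∈ (extChartAt I x₀).target) : ContDiffAt ℝ ∞ (P.projInChart x₀) y := by
  have hs : (extChartAt I x₀).symm y ∈ (chartAt H x₀).source := by
    rw [← extChartAt_source I]
    exact (extChartAt I x₀).map_target hy
  refine contDiffAt_const.clm_comp ?_
  have h1 := P.smooth_proj ((extChartAt I x₀).symm y)
  have h2 := (Trivialization.contMDiffAt_section_iff (IB := I) (n := ∞)
    (e := trivializationAt (E →L[ℝ] E)
      (fun x : M => TangentSpace I x →L[ℝ] TangentSpace I x) x₀) (s := P.projEnd) ⟨hs, hs⟩).mp h1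
  exact (contMDiffAt_iff_comp_extChartAt_symm hy).mp h2

theorem Splitting.apply_proj_extChartAt_symm (P : S.Splitting) {α₀ : S.CharDual}
    {z : E × S.DualFibre} (hz : z ∈ (extChartAt S.dualModel α₀).target) (w : E)
    (v : TangentSpace I ((extChartAt S.dualModel α₀).symm z).1)
    (hv : (v : E) = mfderiv 𝓘(ℝ, E) I (extChartAt I α₀.1).symm z.1 w) :
    ((extChartAt S.dualModel α₀).symm z).2 (P.proj _ v) = z.2 (P.projInChart α₀.1 z.1 w) := by
  have hp : ((extChartAt S.dualModel α₀).symm z).1 = (extChartAt I α₀.1).symm z.1 :=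
    dualProj_extChartAt_symm α₀ z hz
  have hl := (mem_locBase_of_mem_target hz).2
  rw [dual_apply_eq α₀ _ (by rw [hp]; exact hl), (extChartAt S.dualModel α₀).right_inv hz,
    P.incl_proj]
  have key : ∀ x : M, x = (extChartAt I α₀.1).symm z.1 → ∀ v : E,
      (v : E) = mfderiv 𝓘(ℝ, E) I (extChartAt I α₀.1).symm z.1 w →
      S.locP α₀.1 ((trivializationAt E (TangentSpace I) α₀.1).continuousLinearMapAt ℝ x
        (P.projEnd x v)) = P.projInChart α₀.1 z.1 w := by
    rintro x rfl v rfl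
    rw [← symmL_eq_mfderiv (mem_locBase_of_mem_target hz).1]
    rfl
  exact congrArg _ (key _ hp v hv)

theorem mfderiv_dualProj_comp_symm {α₀ : S.CharDual} {z : E × S.DualFibre}
    (hz : z ∈ (extChartAt S.dualModel α₀).target) (w : E × S.DualFibre) :
    (mfderiv S.dualModel I S.dualProj ((extChartAt S.dualModel α₀).symm z)
      (mfderiv 𝓘(ℝ, E × S.DualFibre) S.dualModel (extChartAt S.dualModel α₀).symm z w) : E) =
      mfderiv 𝓘(ℝ, E) I (extChartAt I α₀.1).symm z.1 w.1 := by
  have h1 : MDifferentiableAt S.dualModel I S.dualProj ((extChartAt S.dualModel α₀).symm z) :=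
    (contMDiff_dualProj _).mdifferentiableAt (by simp)
  have h2 : MDifferentiableAt 𝓘(ℝ, E × S.DualFibre) S.dualModel (extChartAt S.dualModel α₀).symm z :=
    (contMDiffAt_extChartAt_symm α₀ hz).mdifferentiableAt (by simp)
  have h3 : MDifferentiableAt 𝓘(ℝ, E) I (extChartAt I α₀.1).symm (Prod.fst z) :=
    (contMDiffAt_extChartAt_symm α₀.1 (mem_locBase_of_mem_target hz).1).mdifferentiableAt (by simp)
  have h4 : MDifferentiableAt 𝓘(ℝ, E × S.DualFibre) 𝓘(ℝ, E) (Prod.fst : E × S.DualFibre → E) z :=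
    differentiableAt_fst.mdifferentiableAt
  have hev : (S.dualProj ∘ (extChartAt S.dualModel α₀).symm) =ᶠ[𝓝 z]
      ((extChartAt I α₀.1).symm ∘ Prod.fst) := by
    filter_upwards [(isOpen_extChartAt_target α₀).mem_nhds hz] with y hy
    exact dualProj_extChartAt_symm α₀ y hy
  have e1 := mfderiv_comp z h1 h2
  have e2 := mfderiv_comp z h3 h4
  have e3 : (mfderiv 𝓘(ℝ, E × S.DualFibre) I (S.dualProj ∘ (extChartAt S.dualModel α₀).symm) z :
      E × S.DualFibre →L[ℝ] E) =
      mfderiv 𝓘(ℝ, E × S.DualFibre) I ((extChartAt I α₀.1).symm ∘ Prod.fst) z := hev.mfderiv_eq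
  rw [mfderiv_eq_fderiv, fderiv_fst] at e2
  exact DFunLike.congr_fun (e1.symm.trans (e3.trans e2)) w

/-- The coordinate expression of `θ_G`. -/
theorem Splitting.theta_inChart_apply (P : S.Splitting) {α₀ : S.CharDual} {z : E × S.DualFibre}
    (hz : z ∈ (extChartAt S.dualModel α₀).target) (w : Fin 1 → E × S.DualFibre) :
    P.theta.inChart α₀ z w = z.2 (P.projInChart α₀.1 z.1 (w 0).1) :=
  P.apply_proj_extChartAt_symm hz (w 0).1 _ (mfderiv_dualProj_comp_symm hz (w 0))

theorem contDiffAt_snd_apply {F G : Type*} [NormedAddCommGroup F] [NormedSpace ℝ F]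
    [NormedAddCommGroup G] [NormedSpace ℝ G] {A : E → F} {z : E × (F →L[ℝ] G)}
    (hA : ContDiffAt ℝ ∞ A z.1) : ContDiffAt ℝ ∞ (fun z : E × (F →L[ℝ] G) => z.2 (A z.1)) z :=
  contDiffAt_snd.clm_apply (hA.comp z contDiffAt_fst)

theorem fderiv_snd_apply_of_snd_eq_zero {F G : Type*} [NormedAddCommGroup F] [NormedSpace ℝ F]
    [NormedAddCommGroup G] [NormedSpace ℝ G] {A : E → F} {z : E × (F →L[ℝ] G)}
    (hA : DifferentiableAt ℝ A z.1) (hz : z.2 = 0) (w : E × (F →L[ℝ] G)) :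
    fderiv ℝ (fun z : E × (F →L[ℝ] G) => z.2 (A z.1)) z w = w.2 (A z.1) := by
  have h := (hasFDerivAt_snd (𝕜 := ℝ) (p := z)).clm_apply
    (HasFDerivAt.comp z hA.hasFDerivAt hasFDerivAt_fst)
  refine (DFunLike.congr_fun h.fderiv w).trans ?_
  simp [hz]

theorem Splitting.theta_smooth (P : S.Splitting) : P.theta.SmoothOn univ :=
  smoothOn_univ_iff.mpr fun α₀ z hz => contDiffAt_of_alternating_apply fun w => by
    have h : ContDiffAt ℝ ∞ (fun z : E × S.DualFibre => z.2 (P.projInChart α₀.1 z.1 (w 0).1)) z :=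
      contDiffAt_snd_apply (A := fun y => P.projInChart α₀.1 y (w 0).1)
        ((P.contDiffAt_projInChart (mem_locBase_of_mem_target hz).1).clm_apply contDiffAt_const)
    refine h.congr_of_eventuallyEq ?_
    filter_upwards [(isOpen_extChartAt_target α₀).mem_nhds hz] with y hy
    exact P.theta_inChart_apply hy w

/-- The function `α ↦ α (p_G ξ)` on `E*`. -/
def Splitting.momentum (P : S.Splitting) (ξ : (x : M) → TangentSpace I x) (α : S.CharDual) : ℝ :=
  α.2 (P.proj α.1 (ξ α.1))

theorem Splitting.momentum_extChartAt_symm (P : S.Splitting) (ξ : (x : M) → TangentSpace I x)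
    {α₀ : S.CharDual} {z : E × S.DualFibre} (hz : z ∈ (extChartAt S.dualModel α₀).target) :
    P.momentum ξ ((extChartAt S.dualModel α₀).symm z) =
      z.2 (P.projInChart α₀.1 z.1 (vfInChart ξ α₀.1 z.1)) := by
  refine P.apply_proj_extChartAt_symm hz _ _ ?_
  have h := mfderiv_extChartAt_symm_comp α₀.1 (mem_locBase_of_mem_target hz).1
    (ξ ((extChartAt I α₀.1).symm z.1))
  refine Eq.trans ?_ h.symm
  have key : ∀ x y : M, x = y → (ξ x : E) = ξ y := by
    rintro x y rfl
    rfl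
  exact key _ _ (dualProj_extChartAt_symm α₀ z hz)

theorem Splitting.contDiffAt_projInChart_vfInChart (P : S.Splitting)
    {ξ : (x : M) → TangentSpace I x} (hξ : SmoothVFOn ξ univ) {x₀ : M} {y : E}
    (hy : y ∈ (extChartAt I x₀).target) :
    ContDiffAt ℝ ∞ (fun y => P.projInChart x₀ y (vfInChart ξ x₀ y)) y :=
  (P.contDiffAt_projInChart hy).clm_apply
    ((smoothVFOn_iff isOpen_univ).mp hξ x₀ y hy (mem_univ _))

theorem Splitting.contMDiff_momentum (P : S.Splitting) {ξ : (x : M) → TangentSpace I x}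
    (hξ : SmoothVFOn ξ univ) : ContMDiff S.dualModel 𝓘(ℝ, ℝ) ∞ (P.momentum ξ) :=
  contMDiff_iff_comp_extChartAt_symm.mpr fun α₀ z hz => by
    have h := contDiffAt_snd_apply (G := ℝ) (z := z)
      (P.contDiffAt_projInChart_vfInChart hξ (mem_locBase_of_mem_target hz).1)
    refine h.congr_of_eventuallyEq ?_
    filter_upwards [(isOpen_extChartAt_target α₀).mem_nhds hz] with y hy
    exact P.momentum_extChartAt_symm ξ hy

theorem extChartAt_zeroSec_snd {x y : M} (hy : y ∈ S.locBase x) :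
    (extChartAt S.dualModel (S.zeroSec x) (S.zeroSec y)).2 = 0 := by
  rw [FiberBundle.extChartAt]
  exact congrArg Prod.snd ((trivializationAt S.DualFibre
    (fun x : M => S.Char x →L[ℝ] Trivial M ℝ x) x).zeroSection ℝ ⟨hy, mem_univ _⟩)

theorem mfderiv_dualProj_apply (α : S.CharDual) (w : TangentSpace S.dualModel α) :
    (mfderiv S.dualModel I S.dualProj α w : E) = (w : E × S.DualFibre).1 := by
  have h := mfderiv_dualProj_comp_symm (mem_extChartAt_target (I := S.dualModel) α) w
  have key : ∀ β : S.CharDual, β = α → ∀ v u : E × S.DualFibre, v = u →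
      (mfderiv S.dualModel I S.dualProj β v : E) = mfderiv S.dualModel I S.dualProj α u := by
    rintro β rfl v u rfl
    rfl
  refine (key _ (extChartAt_to_inv (I := S.dualModel) α) _ _
    (mfderiv_extChartAt_symm_self_apply (I := S.dualModel) α w)).symm.trans (h.trans ?_)
  have h1 : (extChartAt S.dualModel α α).1 = extChartAt I α.1 α.1 := by
    rw [FiberBundle.extChartAt]
    rfl
  rw [h1]
  exact mfderiv_extChartAt_symm_self_apply α.1 _

theorem mfderiv_zeroSec (x : M) (v : TangentSpace I x) :
    (mfderiv I S.dualModel S.zeroSec x v : E × S.DualFibre) = ((v : E), 0) := by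
  have hz : MDifferentiableAt I S.dualModel S.zeroSec x :=
    (contMDiff_zeroSec x).mdifferentiableAt (by simp)
  refine Prod.ext ?_ ?_
  · have h1 := mfderiv_dualProj_apply (S.zeroSec x) (mfderiv I S.dualModel S.zeroSec x v)
    refine h1.symm.trans ?_
    have hp : MDifferentiableAt S.dualModel I S.dualProj (S.zeroSec x) :=
      (contMDiff_dualProj _).mdifferentiableAt (by simp)
    have h2 := mfderiv_comp x hp hz
    have h3 : S.dualProj ∘ S.zeroSec = id := rfl
    rw [h3, mfderiv_id] at h2
    exact (DFunLike.congr_fun h2 v).symm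
  · let σ : S.CharDual → E × S.DualFibre := extChartAt S.dualModel (S.zeroSec x)
    have hσ : MDifferentiableAt S.dualModel 𝓘(ℝ, E × S.DualFibre) σ (S.zeroSec x) :=
      (contMDiffAt_extChartAt (n := ∞)).mdifferentiableAt (by simp)
    have hs : MDifferentiableAt 𝓘(ℝ, E × S.DualFibre) 𝓘(ℝ, S.DualFibre)
        (Prod.snd : E × S.DualFibre → S.DualFibre) (σ (S.zeroSec x)) :=
      differentiableAt_snd.mdifferentiableAt
    have hev : (Prod.snd ∘ (σ ∘ S.zeroSec)) =ᶠ[𝓝 x] fun _ => (0 : S.DualFibre) := by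
      filter_upwards [(S.isOpen_locBase x).mem_nhds (S.mem_locBase x)] with y hy
      exact extChartAt_zeroSec_snd hy
    have e1 := mfderiv_comp x hs (hσ.comp x hz)
    have e2 := mfderiv_comp x hσ hz
    have e3 : (mfderiv I 𝓘(ℝ, S.DualFibre) (Prod.snd ∘ (σ ∘ S.zeroSec)) x : E →L[ℝ] S.DualFibre) =
        mfderiv I 𝓘(ℝ, S.DualFibre) (fun _ : M => (0 : S.DualFibre)) x := hev.mfderiv_eq
    rw [mfderiv_const] at e3
    rw [e2, mfderiv_eq_fderiv, fderiv_snd] at e1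
    have e4 := DFunLike.congr_fun (e1.symm.trans e3) v
    have e5 := mfderiv_extChartAt_self_apply (I := S.dualModel) (S.zeroSec x)
      (mfderiv I S.dualModel S.zeroSec x v)
    exact (congrArg Prod.snd e5).symm.trans e4

end LCPS
end DualBundle

section Nondegenerate

variable {E : Type*} [NormedAddCommGroup E] [NormedSpace ℝ E] [FiniteDimensional ℝ E]
  {H : Type*} [TopologicalSpace H] {I : ModelWithCorners ℝ E H} [I.Boundaryless]
  {M : Type*} [TopologicalSpace M] [ChartedSpace H M] [IsManifold I ∞ M]

namespace Form

theorem eq_of_interior_eq {Ω : Form I M 2} {x : M} (h : Ω.nullSpace x = ⊥)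
    {v w : TangentSpace I x} (hvw : ∀ u, Ω x ![v, u] = Ω x ![w, u]) : v = w := by
  have hm : v - w ∈ Ω.nullSpace x := by
    have h1 : ContinuousAlternatingMap.curryLeft (E := E) (Ω x) v =
        ContinuousAlternatingMap.curryLeft (E := E) (Ω x) w := by
      ext u
      have hu : u = ![u 0] := by ext j; fin_cases j; rfl
      rw [hu]
      exact hvw (u 0)
    refine (ContinuousLinearMap.map_sub (ContinuousAlternatingMap.curryLeft (E := E) (Ω x)) v
      w).trans ?_
    rw [h1]
    exact sub_self _
  rw [h] at hm
  exact sub_eq_zero.mp hm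

theorem isInvertible_inChart {Ω : Form I M 2} {x₀ : M} {z : E} (hz : z ∈ (extChartAt I x₀).target)
    (h : Ω.nullSpace ((extChartAt I x₀).symm z) = ⊥) :
    ((Ω.inChart x₀ z).curryLeft).IsInvertible := by
  refine isInvertible_of_injective ?_
  rw [injective_iff_map_eq_zero]
  intro v hv
  have h1 : mfderiv 𝓘(ℝ, E) I (extChartAt I x₀).symm z v = 0 := by
    have hm : mfderiv 𝓘(ℝ, E) I (extChartAt I x₀).symm z v ∈
        Ω.nullSpace ((extChartAt I x₀).symm z) := by
      rw [Form.mem_nullSpace]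
      intro w
      have h2 : Ω.inChart x₀ z
          ![v, mfderiv I 𝓘(ℝ, E) (extChartAt I x₀) ((extChartAt I x₀).symm z) w] = 0 :=
        congrArg (fun f : E [⋀^Fin 1]→L[ℝ] ℝ =>
          f ![mfderiv I 𝓘(ℝ, E) (extChartAt I x₀) ((extChartAt I x₀).symm z) w]) hv
      rw [inChart_apply] at h2
      refine Eq.trans ?_ h2
      congr 1
      ext i
      fin_cases i
      · rfl
      · exact (mfderiv_extChartAt_symm_comp x₀ hz w).symm
    rw [h] at hm
    exact hm
  have h2 := mfderiv_extChartAt_comp_symm x₀ hz v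
  rw [h1] at h2
  exact h2.symm.trans (ContinuousLinearMap.map_zero _)

/-- The vector field `X` with `X ⌟ Ω = μ`, where `Ω` is non-degenerate. -/
def sharp (Ω : Form I M 2) (μ : Form I M 1) (x : M) : TangentSpace I x :=
  (ContinuousAlternatingMap.curryLeft (E := E) (Ω x)).inverse (μ x)

theorem interior_sharp {Ω : Form I M 2} (μ : Form I M 1) {x : M} (h : Ω.nullSpace x = ⊥) :
    Ω.interior (Ω.sharp μ) x = μ x := by
  have hi := isInvertible_inChart (Ω := Ω) (mem_extChartAt_target (I := I) x)
    (by rwa [extChartAt_to_inv])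
  rw [inChart_self] at hi
  exact hi.self_apply_inverse _

theorem smoothVFOn_sharp {Ω : Form I M 2} {μ : Form I M 1} (hΩ : Ω.SmoothOn univ)
    (hμ : μ.SmoothOn univ) {U : Set M} (hU : IsOpen U) (h : ∀ x ∈ U, Ω.nullSpace x = ⊥) :
    SmoothVFOn (Ω.sharp μ) U := by
  refine (smoothVFOn_iff hU).mpr fun x₀ z hz hzU => ?_
  have hev : vfInChart (Ω.sharp μ) x₀ =ᶠ[𝓝 z]
      fun y => ((Ω.inChart x₀ y).curryLeft).inverse (μ.inChart x₀ y) := by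
    have hc := (contMDiffAt_extChartAt_symm (I := I) x₀ hz).continuousAt
    filter_upwards [hc.preimage_mem_nhds (hU.mem_nhds hzU),
      (isOpen_extChartAt_target x₀).mem_nhds hz] with y hyU hy
    have hi := isInvertible_inChart hy (h _ hyU)
    have h1 : (Ω.interior (Ω.sharp μ)).inChart x₀ y = μ.inChart x₀ y := by
      ext v
      rw [inChart_apply, inChart_apply, interior_sharp μ (h _ hyU)]
    rw [inChart_interior _ _ _ hy] at h1
    rw [← h1]
    exact (hi.inverse_apply_self _).symm
  refine ContDiffAt.congr_of_eventuallyEq ?_ hev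
  obtain ⟨e, he⟩ := isInvertible_inChart hz (h _ hzU)
  have hinv := contDiffAt_map_inverse (n := ∞) e
  rw [he] at hinv
  let L := (ContinuousAlternatingMap.curryLeftLI (𝕜 := ℝ) (E := E) (F := ℝ)
    (n := 1)).toContinuousLinearMap
  have hL : ContDiff ℝ ∞ L := ContinuousLinearMap.contDiff _
  have hLΩ : ContDiffAt ℝ ∞ (fun y => (Ω.inChart x₀ y).curryLeft) z :=
    hL.contDiffAt.comp z (hΩ.contDiffAt hz)
  exact (hinv.comp z hLΩ).clm_apply (hμ.contDiffAt hz)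

end Form

end Nondegenerate

section Extension

variable {E : Type*} [NormedAddCommGroup E] [NormedSpace ℝ E] [FiniteDimensional ℝ E]
  {H : Type*} [TopologicalSpace H] {I : ModelWithCorners ℝ E H} [I.Boundaryless]
  {M : Type*} [TopologicalSpace M] [ChartedSpace H M] [IsManifold I ∞ M]

namespace LCPS

variable {S : LCPS I M}

theorem bDual_smooth : S.bDual.SmoothOn univ := S.b_smooth.pullback contMDiff_dualProj

theorem bDual_closed : S.bDual.d = 0 := by
  unfold bDual
  rw [Form.d_pullback S.b_smooth contMDiff_dualProj, S.b_closed]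
  rfl

namespace Splitting

variable (P : S.Splitting)

theorem formG_eq :
    P.formG = S.form.pullback S.dualProj - Form.twistedD S.bDual P.theta :=
  sub_sub _ _ _

theorem formG_smooth : P.formG.SmoothOn univ := by
  rw [formG_eq]
  exact (S.form_smooth.pullback contMDiff_dualProj).sub (bDual_smooth.twistedD P.theta_smooth)

theorem formG_closed : Form.twistedD S.bDual P.formG = 0 := by
  rw [formG_eq, Form.twistedD_sub _ (S.form_smooth.pullback contMDiff_dualProj)
    (bDual_smooth.twistedD P.theta_smooth),
    Form.twistedD_twistedD bDual_smooth P.theta_smooth bDual_closed, sub_zero]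
  refine (Form.pullback_twistedD S.form_smooth contMDiff_dualProj).symm.trans ?_
  rw [S.form_closed]
  rfl

/-- The one-form `π* (ξ ⌟ ω) + d^b (α ↦ α (p_G ξ)) - c θ_G` on `E*`. -/
def potential (ξ : (x : M) → TangentSpace I x) (c : M → ℝ) : Form S.dualModel S.CharDual 1 :=
  (S.form.interior ξ).pullback S.dualProj + Form.twistedD S.bDual (Form.ofFun (P.momentum ξ)) -
    Form.fsmul (c ∘ S.dualProj) P.theta

variable {ξ : (x : M) → TangentSpace I x} {c : M → ℝ}

theorem potential_smooth (hξ : SmoothVFOn ξ univ) (hc : ContMDiff I 𝓘(ℝ, ℝ) ∞ c) :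
    (P.potential ξ c).SmoothOn univ :=
  (((S.form_smooth.interior hξ).pullback contMDiff_dualProj).add
    (bDual_smooth.twistedD (Form.smoothOn_ofFun (P.contMDiff_momentum hξ)))).sub
    (Form.SmoothOn.smul (hc.comp contMDiff_dualProj) P.theta_smooth)

theorem d_ofFun_comp_dualProj (hc : ContMDiff I 𝓘(ℝ, ℝ) ∞ c)
    (hd : (Form.ofFun c : Form I M 0).d = 0) :
    (Form.ofFun (c ∘ S.dualProj) : Form S.dualModel S.CharDual 0).d = 0 := by
  refine (Form.d_pullback (Form.smoothOn_ofFun hc) (contMDiff_dualProj (S := S))).trans ?_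
  rw [hd]
  rfl

theorem twistedD_potential (hξ : SmoothVFOn ξ univ) (hc : ContMDiff I 𝓘(ℝ, ℝ) ∞ c)
    (hd : (Form.ofFun c : Form I M 0).d = 0)
    (h : Form.twistedD S.b (S.form.interior ξ) = Form.fsmul c S.form) :
    Form.twistedD S.bDual (P.potential ξ c) = Form.fsmul (c ∘ S.dualProj) P.formG := by
  have h1 := (S.form_smooth.interior hξ).pullback (contMDiff_dualProj (S := S))
  have h2 := Form.smoothOn_ofFun (P.contMDiff_momentum hξ)
  have h3 := hc.comp (contMDiff_dualProj (S := S))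
  unfold potential
  rw [Form.twistedD_sub _ (h1.add (bDual_smooth.twistedD h2)) (P.theta_smooth.smul h3),
    Form.twistedD_add _ h1 (bDual_smooth.twistedD h2),
    Form.twistedD_twistedD bDual_smooth h2 bDual_closed, add_zero,
    Form.twistedD_smul h3 P.theta_smooth (d_ofFun_comp_dualProj hc hd), formG_eq]
  have h4 := Form.pullback_twistedD (β := S.b) (S.form_smooth.interior hξ)
    (contMDiff_dualProj (S := S))
  rw [h] at h4
  refine (congrArg (· - Form.fsmul (c ∘ S.dualProj) (Form.twistedD S.bDual P.theta))
    h4.symm).trans ?_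
  funext α
  exact (smul_sub (c (S.dualProj α)) ((S.form.pullback S.dualProj : Form S.dualModel S.CharDual 2) α)
    (Form.twistedD S.bDual P.theta α)).symm

end Splitting
end LCPS
end Extension

section Main

variable {E : Type*} [NormedAddCommGroup E] [NormedSpace ℝ E] [FiniteDimensional ℝ E]
  {H : Type*} [TopologicalSpace H] {I : ModelWithCorners ℝ E H} [I.Boundaryless]
  {M : Type*} [TopologicalSpace M] [ChartedSpace H M] [IsManifold I ∞ M]

theorem extDeriv_one_apply {V : Type*} [NormedAddCommGroup V] [NormedSpace ℝ V]
    {η : V → V [⋀^Fin 1]→L[ℝ] ℝ} {z : V} (hη : DifferentiableAt ℝ η z) (v w : V) :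
    extDeriv η z ![v, w] =
      fderiv ℝ (fun y => η y ![w]) z v - fderiv ℝ (fun y => η y ![v]) z w := by
  have e0 : Fin.removeNth (0 : Fin 2) ![v, w] = ![w] := by ext j; fin_cases j; rfl
  have e1 : Fin.removeNth (1 : Fin 2) ![v, w] = ![v] := by ext j; fin_cases j; rfl
  rw [extDeriv_apply hη, Fin.sum_univ_two, e0, e1]
  simp [sub_eq_add_neg]

theorem Form.d_ofFun_apply (f : M → ℝ) (x : M) (v : E) :
    (Form.ofFun f : Form I M 0).d x ![v] =
      fderiv ℝ (fun z => f ((extChartAt I x).symm z)) (extChartAt I x x) v := by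
  rw [Form.d_eq]
  exact DFunLike.congr_fun (extDeriv_constOfIsEmpty (fun z => f ((extChartAt I x).symm z))
    (extChartAt I x x)) ![v]

namespace LCPS.Splitting

variable {S : LCPS I M} (P : S.Splitting) {ξ : (x : M) → TangentSpace I x} {c : M → ℝ}

theorem d_theta_zeroSec (x : M) (v w : E × S.DualFibre) :
    P.theta.d (S.zeroSec x) ![v, w] =
      v.2 (P.projInChart x (extChartAt I x x) w.1) - w.2 (P.projInChart x (extChartAt I x x) v.1) := by
  have hz := mem_extChartAt_target (I := S.dualModel) (S.zeroSec x)
  have h1 : (extChartAt S.dualModel (S.zeroSec x) (S.zeroSec x)).1 = extChartAt I x x := by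
    rw [FiberBundle.extChartAt]
    rfl
  have key : ∀ v w : E × S.DualFibre,
      fderiv ℝ (fun y => P.theta.inChart (S.zeroSec x) y ![w])
        (extChartAt S.dualModel (S.zeroSec x) (S.zeroSec x)) v =
      v.2 (P.projInChart x (extChartAt I x x) w.1) := by
    intro v w
    have hev : (fun y => P.theta.inChart (S.zeroSec x) y ![w])
        =ᶠ[𝓝 (extChartAt S.dualModel (S.zeroSec x) (S.zeroSec x))]
        fun z : E × S.DualFibre => z.2 (P.projInChart x z.1 w.1) := by
      filter_upwards [(isOpen_extChartAt_target (S.zeroSec x)).mem_nhds hz] with y hy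
      exact P.theta_inChart_apply hy ![w]
    have hA : DifferentiableAt ℝ (fun y => P.projInChart x y w.1)
        (extChartAt S.dualModel (S.zeroSec x) (S.zeroSec x)).1 :=
      (((P.contDiffAt_projInChart (mem_locBase_of_mem_target hz).1).clm_apply
        contDiffAt_const).differentiableAt (by simp))
    rw [hev.fderiv_eq]
    refine (fderiv_snd_apply_of_snd_eq_zero hA (extChartAt_zeroSec_snd (S.mem_locBase x)) v).trans ?_
    rw [h1]
  rw [Form.d_eq]
  refine (extDeriv_one_apply (P.theta_smooth.differentiableAt hz) v w).trans ?_
  rw [key, key]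

theorem theta_zeroSec (x : M) : P.theta (S.zeroSec x) = 0 := by
  ext v
  rfl

theorem momentum_zeroSec (ξ : (x : M) → TangentSpace I x) (x : M) :
    P.momentum ξ (S.zeroSec x) = 0 := rfl

theorem d_momentum_zeroSec (hξ : SmoothVFOn ξ univ) (x : M) (w : E × S.DualFibre) :
    (Form.ofFun (P.momentum ξ) : Form S.dualModel S.CharDual 0).d (S.zeroSec x) ![w] =
      w.2 (P.projInChart x (extChartAt I x x) (ξ x)) := by
  have hz := mem_extChartAt_target (I := S.dualModel) (S.zeroSec x)
  have h1 : (extChartAt S.dualModel (S.zeroSec x) (S.zeroSec x)).1 = extChartAt I x x := by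
    rw [FiberBundle.extChartAt]
    rfl
  have hev : (fun y => P.momentum ξ ((extChartAt S.dualModel (S.zeroSec x)).symm y))
      =ᶠ[𝓝 (extChartAt S.dualModel (S.zeroSec x) (S.zeroSec x))]
      fun z : E × S.DualFibre => z.2 (P.projInChart x z.1 (vfInChart ξ x z.1)) := by
    filter_upwards [(isOpen_extChartAt_target (S.zeroSec x)).mem_nhds hz] with y hy
    exact P.momentum_extChartAt_symm ξ hy
  have hA := (P.contDiffAt_projInChart_vfInChart hξ
    (mem_locBase_of_mem_target hz).1).differentiableAt (by simp)
  refine (Form.d_ofFun_apply _ _ w).trans ?_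
  rw [hev.fderiv_eq]
  refine (fderiv_snd_apply_of_snd_eq_zero hA (extChartAt_zeroSec_snd (S.mem_locBase x)) w).trans ?_
  rw [h1]
  have hX : vfInChart ξ x (extChartAt I x x) = ξ x := vfInChart_self ξ x
  rw [← hX]
  rfl

theorem formG_zeroSec (x : M) (v : TangentSpace I x) (w : E × S.DualFibre) :
    P.formG (S.zeroSec x) ![mfderiv I S.dualModel S.zeroSec x v, w] =
      S.form x ![v, w.1] + w.2 (P.projInChart x (extChartAt I x x) v) := by
  have h1 : (S.form.pullback S.dualProj : Form S.dualModel S.CharDual 2) (S.zeroSec x)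
      ![mfderiv I S.dualModel S.zeroSec x v, w] = S.form x ![v, w.1] := by
    change S.form x _ = _
    congr 1
    ext i
    fin_cases i
    · refine (mfderiv_dualProj_apply _ _).trans ?_
      rw [mfderiv_zeroSec]
      rfl
    · exact mfderiv_dualProj_apply _ _
  have h2 := P.d_theta_zeroSec x (mfderiv I S.dualModel S.zeroSec x v) w
  rw [mfderiv_zeroSec] at h2
  have h3 : (S.bDual.wedge P.theta) (S.zeroSec x) = 0 := by
    exact (congrArg (LCS.wedge (V := E × S.DualFibre) (S.bDual _)) (P.theta_zeroSec x)).trans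
      (wedgeL (E × S.DualFibre) 1 (S.bDual (S.zeroSec x))).map_zero
  have h4 : P.formG (S.zeroSec x) ![mfderiv I S.dualModel S.zeroSec x v, w] =
      (S.form.pullback S.dualProj : Form S.dualModel S.CharDual 2) (S.zeroSec x)
        ![mfderiv I S.dualModel S.zeroSec x v, w] -
      P.theta.d (S.zeroSec x) ![mfderiv I S.dualModel S.zeroSec x v, w] -
      (S.bDual.wedge P.theta) (S.zeroSec x) ![mfderiv I S.dualModel S.zeroSec x v, w] := rfl
  rw [h4, h1, h3, mfderiv_zeroSec]
  have h5 : ∀ a b c : ℝ, b = 0 - c → a - b - 0 = a + c := fun a b c h => by rw [h]; ring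
  exact h5 _ _ _ h2

theorem potential_zeroSec (hξ : SmoothVFOn ξ univ) (x : M) (w : E × S.DualFibre) :
    P.potential ξ c (S.zeroSec x) ![w] =
      S.form x ![ξ x, w.1] + w.2 (P.projInChart x (extChartAt I x x) (ξ x)) := by
  have h1 : ((S.form.interior ξ).pullback S.dualProj : Form S.dualModel S.CharDual 1) (S.zeroSec x)
      ![w] = S.form x ![ξ x, w.1] := by
    change S.form x _ = _
    congr 1
    ext i
    fin_cases i
    · rfl
    · exact mfderiv_dualProj_apply _ _
  have h0 : (Form.ofFun (P.momentum ξ) : Form S.dualModel S.CharDual 0) (S.zeroSec x) = 0 := by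
    ext v
    exact P.momentum_zeroSec ξ x
  have h3 : (S.bDual.wedge (Form.ofFun (P.momentum ξ))) (S.zeroSec x) = 0 := by
    exact (congrArg (LCS.wedge (V := E × S.DualFibre) (S.bDual _)) h0).trans
      (wedgeL (E × S.DualFibre) 0 (S.bDual (S.zeroSec x))).map_zero
  have h4 : P.potential ξ c (S.zeroSec x) ![w] =
      ((S.form.interior ξ).pullback S.dualProj : Form S.dualModel S.CharDual 1) (S.zeroSec x) ![w] +
      ((Form.ofFun (P.momentum ξ) : Form S.dualModel S.CharDual 0).d (S.zeroSec x) ![w] +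
        (S.bDual.wedge (Form.ofFun (P.momentum ξ))) (S.zeroSec x) ![w]) -
      c x • P.theta (S.zeroSec x) ![w] := rfl
  rw [h4, h1, h3, P.theta_zeroSec, P.d_momentum_zeroSec hξ]
  have h5 : ∀ a b : ℝ, a + (b + 0) - c x • 0 = a + b := fun a b => by simp
  exact h5 _ _

variable {U : Set S.CharDual}

theorem extends_sharp (hU : P.IsThickening U) (hξ : SmoothVFOn ξ univ) :
    S.Extends (P.formG.sharp (P.potential ξ c)) ξ := by
  intro x
  have hn := hU.nondegenerate _ (hU.zeroSec_mem x)
  refine Form.eq_of_interior_eq hn fun u => ?_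
  have h1 : P.formG (S.zeroSec x) ![P.formG.sharp (P.potential ξ c) (S.zeroSec x), u] =
      P.potential ξ c (S.zeroSec x) ![u] :=
    congrArg (fun f : (E × S.DualFibre) [⋀^Fin 1]→L[ℝ] ℝ => f ![u])
      (Form.interior_sharp (P.potential ξ c) hn)
  exact h1.trans ((P.potential_zeroSec hξ x u).trans (P.formG_zeroSec x (ξ x) u).symm)

theorem exists_conformal_extension (hU : P.IsThickening U)
    (hξ : IsConformalVFOn S.form S.b univ ξ) :
    ∃ X : (α : S.CharDual) → TangentSpace S.dualModel α,
      IsConformalVFOn P.formG S.bDual U X ∧ S.Extends X ξ := by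
  obtain ⟨hξs, u, hu, hL⟩ := hξ
  have hu' : ContMDiff I 𝓘(ℝ, ℝ) ∞ u := contMDiffOn_univ.mp hu
  have hbξ : ∀ x, ContMDiffAt I 𝓘(ℝ, ℝ) ∞ (S.b.contract ξ) x :=
    fun x => Form.contMDiffAt_contract S.b_smooth isOpen_univ hξs (mem_univ x)
  have hξd : ∀ x, DifferentiableAt ℝ (vfInChart ξ x) (extChartAt I x x) := fun x =>
    ((smoothVFOn_iff isOpen_univ).mp hξs x _ (mem_extChartAt_target x)
      (mem_univ _)).differentiableAt (by simp)
  let c : M → ℝ := fun x => S.b.contract ξ x - u x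
  have hc : ContMDiff I 𝓘(ℝ, ℝ) ∞ c := fun x => (hbξ x).sub (hu' x)
  have hcd : (Form.ofFun c : Form I M 0).d = 0 := by
    funext x
    rw [Form.d_ofFun_sub (hbξ x) (hu' x)]
    refine sub_eq_zero.mpr ?_
    ext v
    rw [← (hL x (mem_univ x)).2 v]
    exact (Form.lieDeriv_closed (S.b_smooth.differentiableAt (mem_extChartAt_target x)) (hξd x)
      S.b_closed v).symm
  have htw : Form.twistedD S.b (S.form.interior ξ) = Form.fsmul c S.form := by
    funext x
    ext v
    have h1 := Form.lieDeriv_eq_twistedD (β := S.b)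
      (S.form_smooth.differentiableAt (mem_extChartAt_target x)) (hξd x)
      (congrFun S.form_closed x) v
    rw [(hL x (mem_univ x)).1 v] at h1
    change _ = (S.b x ![ξ x] - u x) * S.form x v
    linarith
  have hμ := P.potential_smooth hξs hc
  have hX := Form.smoothVFOn_sharp P.formG_smooth hμ hU.isOpen hU.nondegenerate
  have hint : ∀ α ∈ U, P.formG.interior (P.formG.sharp (P.potential ξ c)) α = P.potential ξ c α :=
    fun α hα => Form.interior_sharp _ (hU.nondegenerate α hα)
  have hbX : ∀ α ∈ U, ContMDiffAt S.dualModel 𝓘(ℝ, ℝ) ∞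
      (S.bDual.contract (P.formG.sharp (P.potential ξ c))) α :=
    fun α hα => Form.contMDiffAt_contract bDual_smooth hU.isOpen hX hα
  have hcπ := hc.comp (contMDiff_dualProj (S := S))
  refine ⟨P.formG.sharp (P.potential ξ c), ⟨hX, fun α =>
    S.bDual.contract (P.formG.sharp (P.potential ξ c)) α - (c ∘ S.dualProj) α,
    fun α hα => ((hbX α hα).sub (hcπ α)).contMDiffWithinAt, fun α hα => ?_⟩, P.extends_sharp hU hξs⟩
  have hz := mem_extChartAt_target (I := S.dualModel) α
  have hXd : DifferentiableAt ℝ (vfInChart (P.formG.sharp (P.potential ξ c)) α)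
      (extChartAt S.dualModel α α) :=
    ((smoothVFOn_iff hU.isOpen).mp hX α _ hz (by rwa [extChartAt_to_inv])).differentiableAt (by simp)
  constructor
  · intro v
    rw [Form.lieDeriv_eq_twistedD (β := S.bDual) (P.formG_smooth.differentiableAt hz) hXd
      (congrFun P.formG_closed α) v]
    have h1 : Form.twistedD S.bDual (P.formG.interior (P.formG.sharp (P.potential ξ c))) α =
        Form.twistedD S.bDual (P.potential ξ c) α := by
      have h2 := Form.d_congr hU.isOpen hint hα
      have h3 : S.bDual.wedge (P.formG.interior (P.formG.sharp (P.potential ξ c))) α =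
          S.bDual.wedge (P.potential ξ c) α :=
        congrArg (LCS.wedge (V := E × S.DualFibre) (S.bDual α)) (hint α hα)
      exact congrArg₂ (fun a b : (E × S.DualFibre) [⋀^Fin 2]→L[ℝ] ℝ => a + b) h2 h3
    rw [h1, P.twistedD_potential hξs hc hcd htw]
    change (c ∘ S.dualProj) α * P.formG α v - _ * _ = -(S.bDual α ![_] - _) * _
    ring
  · intro v
    rw [Form.lieDeriv_closed (bDual_smooth.differentiableAt hz) hXd bDual_closed v,
      Form.d_ofFun_sub (hbX α hα) (hcπ α), d_ofFun_comp_dualProj hc hcd]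
    exact (sub_zero _).symm

theorem exists_hamiltonian_extension (hU : P.IsThickening U)
    (hξ : IsHamiltonianVFOn S.form S.b univ ξ) :
    ∃ X : (α : S.CharDual) → TangentSpace S.dualModel α,
      IsHamiltonianVFOn P.formG S.bDual U X ∧ S.Extends X ξ := by
  obtain ⟨hξs, f, hf, hL⟩ := hξ
  have hf' : ContMDiff I 𝓘(ℝ, ℝ) ∞ f := contMDiffOn_univ.mp hf
  have hfπ := hf'.comp (contMDiff_dualProj (S := S))
  have hh := P.contMDiff_momentum hξs
  have hμ := P.potential_smooth (c := 0) hξs contMDiff_const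
  have hμe : P.potential ξ 0 =
      Form.twistedD S.bDual (Form.ofFun (f ∘ S.dualProj + P.momentum ξ)) := by
    have h1 : S.form.interior ξ = Form.twistedD S.b (Form.ofFun f) :=
      funext fun x => hL x (mem_univ x)
    have h2 : (Form.ofFun (f ∘ S.dualProj + P.momentum ξ) : Form S.dualModel S.CharDual 0) =
        Form.ofFun (f ∘ S.dualProj) + Form.ofFun (P.momentum ξ) := rfl
    have h3 : Form.fsmul ((0 : M → ℝ) ∘ S.dualProj) P.theta = 0 :=
      funext fun α => zero_smul ℝ (P.theta α)
    rw [h2, Form.twistedD_add _ (Form.smoothOn_ofFun hfπ) (Form.smoothOn_ofFun hh), potential, h1,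
      h3, sub_zero, Form.pullback_twistedD (Form.smoothOn_ofFun hf') contMDiff_dualProj]
    rfl
  refine ⟨P.formG.sharp (P.potential ξ 0),
    ⟨Form.smoothVFOn_sharp P.formG_smooth hμ hU.isOpen hU.nondegenerate,
      f ∘ S.dualProj + P.momentum ξ, (hfπ.add hh).contMDiffOn, fun α hα => ?_⟩,
    P.extends_sharp hU hξs⟩
  rw [Form.interior_sharp _ (hU.nondegenerate α hα), hμe]

end LCPS.Splitting
end Main
end LCS
end

theorem theorem6p5 {m : ℕ} {Y : Type*} [TopologicalSpace Y] [ChartedSpace (EuclideanSpace ℝ (Fin m)) Y]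
    [IsManifold (𝓡 m) ∞ Y] (S : LCPS (𝓡 m) Y) (P : S.Splitting) (U : Set S.CharDual)
    (hU : P.IsThickening U) (ξ : (y : Y) → TangentSpace (𝓡 m) y) :
    (IsConformalVFOn S.form S.b univ ξ →
      ∃ X : (α : S.CharDual) → TangentSpace S.dualModel α,
        IsConformalVFOn P.formG S.bDual U X ∧ S.Extends X ξ) ∧
    (IsHamiltonianVFOn S.form S.b univ ξ →
      ∃ X : (α : S.CharDual) → TangentSpace S.dualModel α,
        IsHamiltonianVFOn P.formG S.bDual U X ∧ S.Extends X ξ) :=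
  ⟨P.exists_conformal_extension hU, P.exists_hamiltonian_extension hU⟩
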